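/- **Setting.** Let $E$ be a finite-dimensional real vector space with a norm $\|\cdot\|$ and dual norm $\|\cdot\|_*$, let $X\subseteq E$ be compact and convex, and let $\psi:X\to\mathbb R$ be differentiable and $1$-strongly convex with respect to $\|\cdot\|$, with Bregman divergence $D(x,y)=\psi(x)-\psi(y)-\langle\nabla\psi(y),x-y\rangle\le\frac12R^2$ for all $x,y\in X$, where $R\ge 0$. There are $n\ge 2$ processors; processor $i$ has a probability distribution $\Pi_i$ on a measurable space $\Xi$. For each $\xi\in\Xi$ the function $F(\cdot;\xi)$ is convex on $X$, $F(x;\cdot)$ is measurable and $\Pi_i$-integrable for all $x\in X$ and all $i$, and $$f(x)=\frac1n\sum_{i=1}^n\mathbb E_{\Pi_i}[F(x;\xi)].$$ Let $\mathsf G(x;\xi)\in\partial F(x;\xi)$ be a jointly measurable selection of subgradients, i.e. $F(y;\xi)\ge F(x;\xi)+\langle \mathsf G(x;\xi),y-x\rangle$ for $x,y\in X$. For every $i$ and $\Pi_i$-almost every $\xi$, $F(\cdot;\xi)$ is $G$-Lipschitz on $X$ with respect to $\|\cdot\|$ and $\|\mathsf G(x;\xi)\|_*\le G$ for all $x\in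 X$. Let $P(1),P(2),\dots$ be i.i.d. random doubly stochastic $n\times n$ matrices. A token starts at an arbitrary, possibly random, $i(0)\in\{1,\dots,n\}$. At time $t\ge1$ the matrix $P(t)$ is drawn independently of the past; given the past and $P(t)$, the token moves from $i(t-1)$ to $i(t)=j$ with probability $P(t)_{i(t-1),j}$; given all this and $i(t)$, a sample $\xi_t$ is drawn from $\Pi_{i(t)}$. Markov incremental gradient descent (MIGD) starts from an arbitrary fixed $x(1)\in X$ and iterates $$x(t+1)=\operatorname*{argmin}_{x\in X}\Big\{\langle \mathsf G(x(t);\xi_t),x\rangle+\frac1{\alpha(t)}D(x,x(t))\Big\},\qquad \alpha(t)=\frac{\alpha}{\sqrt t},\quad\alpha>0 .$$ Put $\hat x(T)=\frac1T\sum_{t=1}^Tx(t)$, and let $\lambda_2$ be the second largest eigenvalue of the symmetric matrix $\mathbb E[P(1)^\top P(1)]$. Assume $\lambda_2<1$. **Corollary 5.** There is a universal constant $0<C\le4$ such that, in every such setting and for all integers $T\ge1$ and all $\delta\in(0,1]$, with probability at least $1-\delta$ the following holds simultaneously for all $x^\star\in X$ and all $\epsilon\in(0,nT/\delta)$: $$f(\hat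 x(T))-f(x^\star)\le C\left(\frac{R^2}{\alpha\sqrt T}+\frac{\log\frac n\epsilon+\log\frac T\delta}{1-\lambda_2}\cdot\frac{G^2\alpha}{\sqrt T}+\epsilon GR+\frac{GR}{\sqrt T}\sqrt{\frac{\log\frac{Tn}{\epsilon\delta}\;\log\!\Big(\frac1\delta\log\frac{Tn}{\epsilon\delta}\big/(1-\lambda_2)\Big)}{1-\lambda_2}}\,\right),$$ where the square root of a negative number is read as $0$. -/

import Mathlib

open MeasureTheory ProbabilityTheory

open scoped Matrix

noncomputable section

namespace RandomMIGD

/-- The Bregman divergence of `ψ` over `X`,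
`D(x, y) = ψ(x) - ψ(y) - ⟨∇ψ(y), x - y⟩`.  For convex `X` and `x, y ∈ X` the last term is the
derivative of `ψ` at `y` along the segment to `x`, so it does not depend on how `ψ` is extended
outside of `X`. -/
def bregman {E : Type*} [NormedAddCommGroup E] [NormedSpace ℝ E]
    (ψ : E → ℝ) (X : Set E) (x y : E) : ℝ :=
  ψ x - ψ y - fderivWithin ℝ ψ X y (x - y)

/-- `x'` is the mirror descent update
`argmin_{y ∈ X} { ⟨g, y⟩ + (1 / a) D(y, x) }`. -/
def IsMirrorStep {E : Type*} [NormedAddCommGroup E] [NormedSpace ℝ E]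
    (ψ : E → ℝ) (X : Set E) (a : ℝ) (g : E →L[ℝ] ℝ) (x x' : E) : Prop :=
  x' ∈ X ∧ IsMinOn (fun y => g y + (1 / a) * bregman ψ X y x) X x'

/-- `g` is a subgradient at `x` of the convex function `h` on `X`. -/
def IsSubgradientOn {E : Type*} [NormedAddCommGroup E] [NormedSpace ℝ E]
    (h : E → ℝ) (X : Set E) (x : E) (g : E →L[ℝ] ℝ) : Prop :=
  ∀ y ∈ X, h x + g (y - x) ≤ h y

/-- The objective `f(x) = (1/n) ∑ᵢ fᵢ(x)` with `fᵢ(x) = 𝔼_{Πᵢ}[F(x; ·)]`. -/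
def objective {n : ℕ} {E Ξ : Type*} [MeasurableSpace Ξ]
    (F : E → Ξ → ℝ) (loc : Fin n → Measure Ξ) (x : E) : ℝ :=
  (1 / (n : ℝ)) * ∑ i, ∫ z, F x z ∂(loc i)

/-- The average `(1/T) ∑_{t=1}^T x(t)`. -/
def average {E : Type*} [NormedAddCommGroup E] [NormedSpace ℝ E] (x : ℕ → E) (T : ℕ) : E :=
  (1 / (T : ℝ)) • ∑ t ∈ Finset.Icc 1 T, x t

section Sampling

variable {Ω Ξ : Type*} {n : ℕ}

/-- The σ-algebra generated by a random matrix, that is, by its entries. -/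
abbrev matrixSigma (Q : Ω → Matrix (Fin n) (Fin n) ℝ) : MeasurableSpace Ω :=
  ⨆ i, ⨆ j, MeasurableSpace.comap (fun ω => Q ω i j) inferInstance

/-- The σ-algebra of everything that has happened up to and including time `t`: the tokens
`i(0), …, i(t)`, the matrices `P(1), …, P(t)` and the samples `ξ(1), …, ξ(t)`. -/
abbrev history [MeasurableSpace Ξ] (P : ℕ → Ω → Matrix (Fin n) (Fin n) ℝ)
    (token : ℕ → Ω → Fin n) (ξ : ℕ → Ω → Ξ) (t : ℕ) : MeasurableSpace Ω :=
  (⨆ s ∈ Finset.Icc 0 t, MeasurableSpace.comap (token s) ⊤) ⊔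
    ⨆ s ∈ Finset.Icc 1 t, (matrixSigma (P s) ⊔ MeasurableSpace.comap (ξ s) inferInstance)

/-- The sampling mechanism of Markov incremental gradient descent with random transition
matrices.  The matrices `P(1), P(2), …` are i.i.d. and doubly stochastic, `P(t + 1)` being drawn
independently of everything that happened up to time `t`.  The token starts at an arbitrary
`i(0)`; given the history up to time `t` and `P(t + 1)` it moves from `i(t)` to `j` with
probability `P(t + 1)_{i(t), j}`.  Given all this and `i(t + 1)`, the processor `i(t + 1)` draws
the sample `ξ(t + 1)` from its local distribution. -/
structure IsRandomMIGDSampling [MeasurableSpace Ω] [MeasurableSpace Ξ] (μ : Measure Ω)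
    (loc : Fin n → Measure Ξ) (P : ℕ → Ω → Matrix (Fin n) (Fin n) ℝ)
    (token : ℕ → Ω → Fin n) (ξ : ℕ → Ω → Ξ) : Prop where
  measurable_matrix : ∀ t, 1 ≤ t → ∀ i j, Measurable fun ω => P t ω i j
  measurable_token : ∀ t, Measurable (token t)
  measurable_sample : ∀ t, 1 ≤ t → Measurable (ξ t)
  doublyStochastic : ∀ t, 1 ≤ t → ∀ᵐ ω ∂μ, P t ω ∈ _root_.doublyStochastic ℝ (Fin n)
  identDistrib : ∀ t, 1 ≤ t →
    IdentDistrib (fun ω (i j : Fin n) => P t ω i j) (fun ω (i j : Fin n) => P 1 ω i j) μ μ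
  indep : ∀ t, Indep (matrixSigma (P (t + 1))) (history P token ξ t) μ
  token_law : ∀ t (j : Fin n),
    μ[(token (t + 1) ⁻¹' {j}).indicator (fun _ => (1 : ℝ)) |
        history P token ξ t ⊔ matrixSigma (P (t + 1))]
      =ᵐ[μ] fun ω => P (t + 1) ω (token t ω) j
  sample_law : ∀ t (A : Set Ξ), MeasurableSet A →
    μ[(ξ (t + 1) ⁻¹' A).indicator (fun _ => (1 : ℝ)) |
        history P token ξ t ⊔ matrixSigma (P (t + 1)) ⊔
          MeasurableSpace.comap (token (t + 1)) ⊤]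
      =ᵐ[μ] fun ω => (loc (token (t + 1) ω)).real A

/-- The matrix `𝔼[Qᵀ Q]` of a random matrix `Q`. -/
def expectedGram [MeasurableSpace Ω] (μ : Measure Ω) (Q : Ω → Matrix (Fin n) (Fin n) ℝ) :
    Matrix (Fin n) (Fin n) ℝ :=
  Matrix.of fun i j => ∫ ω, ((Q ω)ᵀ * Q ω) i j ∂μ

theorem expectedGram_isHermitian [MeasurableSpace Ω] (μ : Measure Ω)
    (Q : Ω → Matrix (Fin n) (Fin n) ℝ) : (expectedGram μ Q).IsHermitian := by
  ext i j
  simp only [expectedGram, Matrix.conjTranspose_apply, Matrix.of_apply, star_trivial,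
    Matrix.mul_apply, Matrix.transpose_apply, mul_comm]

end Sampling

/-- The second largest eigenvalue (with multiplicity) of a real symmetric `n × n` matrix,
`n ≥ 2`; `eigenvalues₀` lists the eigenvalues in decreasing order, starting from index `0`. -/
def secondEigenvalue {n : ℕ} (hn : 2 ≤ n) (A : Matrix (Fin n) (Fin n) ℝ)
    (hA : A.IsHermitian) : ℝ :=
  hA.eigenvalues₀ ⟨1, by rw [Fintype.card_fin]; omega⟩

/-- `λ₂(𝔼[Qᵀ Q])`. -/
def lambdaTwo {Ω : Type*} [MeasurableSpace Ω] {n : ℕ} (hn : 2 ≤ n) (μ : Measure Ω)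
    (Q : Ω → Matrix (Fin n) (Fin n) ℝ) : ℝ :=
  secondEigenvalue hn (expectedGram μ Q) (expectedGram_isHermitian μ Q)

end RandomMIGD

end

/-! The sample used at round `s + p` is compared with the iterate `x (s + 1)`, which is fixed by the
history up to `s`. Given that history, the mean of `F (x (s + 1)) - F xs` at `ξ (s + p)` is an entry
of `𝔼[P] ^ p` applied to the vector of local means: the matrices are independent of the past, so the
token moves on average by the mean matrix. The optimality gap at `x (s + 1)` therefore splits into
three parts.

Bias: by Jensen, `‖𝔼[P] v‖² ≤ 𝔼 ‖P v‖² = vᵀ 𝔼[PᵀP] v ≤ λ₂ ‖v‖²` for `v` of mean zero, so the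
conditional mean is within `√(n λ₂ ^ p) G R` of the uniform average
(`abs_meanMatrix_pow_mulVec_sub_le`).

Fluctuation: conditional mean minus realised loss. Within a residue class modulo `p` these are
martingale differences, and convexity of `exp` combines the `p` classes with no union bound, giving
a deviation of order `G R √(p T log (1 / δ))` (`measure_sum_sub_ge_le`).

Realised loss: the mirror descent regret, plus the cost of the iterate being `p - 1` rounds old,
which is small because the iterates drift slowly (`sum_delayed_loss_le`).

`measureReal_sum_gap_ge` adds the three. Then `p` of order `log (n / ε) / (1 - λ₂)` makes the bias
`4 ε G R`; the last `p - 1` gaps cost `G R` each. No gap exceeds `G R`, so the claim is trivial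
unless every term of the bound is below `G R`, and that regime supplies the inequalities that
`bound_le_of_mixing` needs for the constant `4`.

Uniformity costs no probability: the competitor may be taken to be a fixed minimizer of the
objective, and for different `ε` the events bound the same random variable by different constants,
hence are nested. -/

namespace RandomMIGD

/-! ### Deterministic analysis of mirror descent: optimality, regret and drift. -/

section MirrorStep

variable {E : Type*} [NormedAddCommGroup E] [NormedSpace ℝ E] {X : Set E} {ψ : E → ℝ}

/-- The directional difference quotients of `ψ` converge to `fderivWithin`. -/
theorem tendsto_segment_slope (hX : Convex ℝ X) (hψ : DifferentiableOn ℝ ψ X) {x y : E}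
    (hx : x ∈ X) (hy : y ∈ X) :
    Filter.Tendsto (fun k : ℕ => ((k : ℝ) + 1) * (ψ (x + (1 / ((k : ℝ) + 1)) • (y - x)) - ψ x))
      Filter.atTop (nhds (fderivWithin ℝ ψ X x (y - x))) := by
  have h := (hψ x hx).hasFDerivWithinAt
  have hd : Filter.Tendsto (fun k : ℕ => (1 / ((k : ℝ) + 1)) • (y - x)) Filter.atTop
      (nhds 0) := by
    simpa using (tendsto_one_div_add_atTop_nhds_zero_nat (𝕜 := ℝ)).smul_const (y - x)
  have hm : ∀ k : ℕ, x + (1 / ((k : ℝ) + 1)) • (y - x) ∈ X := fun k => by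
    have h0 : (0 : ℝ) < (k : ℝ) + 1 := by positivity
    refine hX.add_smul_sub_mem hx hy ⟨by positivity, ?_⟩
    rw [div_le_one h0]; linarith [(Nat.cast_nonneg k : (0 : ℝ) ≤ k)]
  have hv : Filter.Tendsto (fun k : ℕ => ((k : ℝ) + 1) • ((1 / ((k : ℝ) + 1)) • (y - x)))
      Filter.atTop (nhds (y - x)) := by
    refine tendsto_const_nhds.congr fun k => ?_
    have h0 : ((k : ℝ) + 1) ≠ 0 := by positivity
    rw [smul_smul, mul_one_div_cancel h0, one_smul]
  exact h.lim hd (Filter.Eventually.of_forall hm) hv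

/-- Strong convexity on the segment from `y` to `x` bounds the difference quotient at `t = 1 / (k +
1)` by `ψ x - ψ y - (1 - t) / 2 * ‖x - y‖ ^ 2`; let `t → 0`. -/
theorem half_sq_norm_le_bregman (hψ : DifferentiableOn ℝ ψ X)
    (hψc : StrongConvexOn X 1 ψ) {x y : E} (hx : x ∈ X) (hy : y ∈ X) :
    1 / 2 * ‖x - y‖ ^ 2 ≤ bregman ψ X x y := by
  have hlim := tendsto_segment_slope hψc.1 hψ hy hx
  have hup : Filter.Tendsto
      (fun k : ℕ => ψ x - ψ y - (1 - 1 / ((k : ℝ) + 1)) * (1 / 2 * ‖x - y‖ ^ 2))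
      Filter.atTop (nhds (ψ x - ψ y - (1 - 0) * (1 / 2 * ‖x - y‖ ^ 2))) :=
    ((tendsto_one_div_add_atTop_nhds_zero_nat (𝕜 := ℝ)).const_sub 1).mul_const _ |>.const_sub _
  have hle := le_of_tendsto_of_tendsto hlim hup (Filter.Eventually.of_forall fun k => ?_)
  · unfold bregman; linarith
  · have h0 : (0 : ℝ) < (k : ℝ) + 1 := by positivity
    have h1 : 1 / ((k : ℝ) + 1) ≤ 1 := by
      rw [div_le_one h0]; linarith [(Nat.cast_nonneg k : (0 : ℝ) ≤ k)]
    have h2 := hψc.2 hx hy (by positivity : 0 ≤ 1 / ((k : ℝ) + 1))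
      (by linarith : 0 ≤ 1 - 1 / ((k : ℝ) + 1)) (by ring)
    have h3 : y + (1 / ((k : ℝ) + 1)) • (x - y)
        = (1 / ((k : ℝ) + 1)) • x + (1 - 1 / ((k : ℝ) + 1)) • y := by
      module
    simp only [smul_eq_mul] at h2
    calc ((k : ℝ) + 1) * (ψ (y + (1 / ((k : ℝ) + 1)) • (x - y)) - ψ y)
        ≤ ((k : ℝ) + 1) * (1 / ((k : ℝ) + 1) * ψ x + (1 - 1 / ((k : ℝ) + 1)) * ψ y
          - 1 / ((k : ℝ) + 1) * (1 - 1 / ((k : ℝ) + 1)) * (1 / 2 * ‖x - y‖ ^ 2) - ψ y) := by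
          rw [h3]; gcongr
      _ = _ := by field_simp; ring

theorem norm_sub_le_of_bregman_le (hψ : DifferentiableOn ℝ ψ X)
    (hψc : StrongConvexOn X 1 ψ) {R : ℝ} (hR : 0 ≤ R)
    (hD : ∀ x ∈ X, ∀ y ∈ X, bregman ψ X x y ≤ 1 / 2 * R ^ 2) {x y : E} (hx : x ∈ X) (hy : y ∈ X) :
    ‖x - y‖ ≤ R := by
  have h1 := half_sq_norm_le_bregman hψ hψc hx hy
  have h2 := hD x hx y hy
  exact (sq_le_sq₀ (norm_nonneg _) hR).1 (by linarith)

variable {a : ℝ} {g : E →L[ℝ] ℝ} {x x' : E}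

/-- First-order optimality condition of the mirror descent update. -/
theorem IsMirrorStep.optimality (hψ : DifferentiableOn ℝ ψ X) (hX : Convex ℝ X) (ha : 0 < a)
    (h : IsMirrorStep ψ X a g x x') {y : E} (hy : y ∈ X) :
    0 ≤ a * g (y - x') + fderivWithin ℝ ψ X x' (y - x') - fderivWithin ℝ ψ X x (y - x') := by
  obtain ⟨hx', hmin⟩ := h
  have hd : HasFDerivWithinAt (fun y => g y + (1 / a) * bregman ψ X y x)
      (g + (1 / a) • (fderivWithin ℝ ψ X x' - fderivWithin ℝ ψ X x)) X x' := by
    unfold bregman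
    refine g.hasFDerivWithinAt.add (HasFDerivWithinAt.const_mul ?_ _)
    refine ((hψ x' hx').hasFDerivWithinAt.sub_const _).sub ?_
    exact (fderivWithin ℝ ψ X x).hasFDerivWithinAt.comp x'
      ((hasFDerivWithinAt_id x' X).sub_const x) (Set.mapsTo_univ _ _)
  have h1 := hmin.localize.hasFDerivWithinAt_nonneg hd
    (sub_mem_posTangentConeAt_of_segment_subset (hX.segment_subset hx' hy))
  simp only [add_apply, smul_apply,
    sub_apply, smul_eq_mul] at h1
  have h2 := mul_nonneg ha.le h1
  have h3 : a * (1 / a) = 1 := by field_simp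
  rw [mul_add, ← mul_assoc, h3] at h2
  linarith

/-- Quadratic growth of the objective of the update away from its minimizer. -/
theorem IsMirrorStep.growth (hψ : DifferentiableOn ℝ ψ X) (hψc : StrongConvexOn X 1 ψ)
    (ha : 0 < a) (h : IsMirrorStep ψ X a g x x') {y : E} (hy : y ∈ X) :
    g x' + (1 / a) * bregman ψ X x' x + (1 / (2 * a)) * ‖y - x'‖ ^ 2
      ≤ g y + (1 / a) * bregman ψ X y x := by
  have h1 := h.optimality hψ hψc.1 ha hy
  have h2 := half_sq_norm_le_bregman hψ hψc hy h.1
  have h3 : fderivWithin ℝ ψ X x (y - x) =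
      fderivWithin ℝ ψ X x (y - x') + fderivWithin ℝ ψ X x (x' - x) := by
    rw [← map_add]; congr 1; abel
  have h4 : g (y - x') = g y - g x' := map_sub _ _ _
  unfold bregman at h2 ⊢
  rw [h3]
  have h5 : 0 ≤ (1 / a) * (a * (g y - g x') + (ψ y - ψ x') - fderivWithin ℝ ψ X x (y - x')
      - 1 / 2 * ‖y - x'‖ ^ 2) := by
    refine mul_nonneg (by positivity) ?_
    rw [h4] at h1; linarith
  have h6 : (1 / a) * (a * (g y - g x') + (ψ y - ψ x') - fderivWithin ℝ ψ X x (y - x')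
      - 1 / 2 * ‖y - x'‖ ^ 2) = g y - g x' + 1 / a * ((ψ y - ψ x') -
      fderivWithin ℝ ψ X x (y - x')) - (1 / (2 * a)) * ‖y - x'‖ ^ 2 := by
    field_simp
    ring
  rw [h6] at h5
  linarith

/-- By strong convexity `‖x - x'‖²` is at most `D(x, x') + D(x', x)`, and this symmetrized
divergence is at most `a * g (x - x')` by optimality tested at `x`. Dividing by `‖x - x'‖` leaves
the dual norm. -/
theorem IsMirrorStep.norm_sub_le (hψ : DifferentiableOn ℝ ψ X) (hψc : StrongConvexOn X 1 ψ)
    (ha : 0 < a) (hx : x ∈ X) (h : IsMirrorStep ψ X a g x x') : ‖x' - x‖ ≤ a * ‖g‖ := by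
  have h1 := h.optimality hψ hψc.1 ha hx
  have h2 := half_sq_norm_le_bregman hψ hψc hx h.1
  have h3 := half_sq_norm_le_bregman hψ hψc h.1 hx
  have h4 : fderivWithin ℝ ψ X x (x' - x) = - fderivWithin ℝ ψ X x (x - x') := by
    rw [← map_neg]; congr 1; abel
  have h5 : g (x - x') ≤ ‖g‖ * ‖x - x'‖ := (le_abs_self _).trans (g.le_opNorm _)
  have h6 := mul_le_mul_of_nonneg_left h5 ha.le
  unfold bregman at h2 h3
  rw [norm_sub_rev x' x] at h3 ⊢
  rcases (norm_nonneg (x - x')).eq_or_lt with h0 | h0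
  · rw [← h0]; positivity
  · refine le_of_mul_le_mul_right ?_ h0
    nlinarith

/-- The one-step inequality of mirror descent. -/
theorem IsMirrorStep.regret_le (hψ : DifferentiableOn ℝ ψ X) (hψc : StrongConvexOn X 1 ψ)
    (ha : 0 < a) (hx : x ∈ X) (h : IsMirrorStep ψ X a g x x') {y : E} (hy : y ∈ X) :
    g (x - y) ≤ (1 / a) * (bregman ψ X y x - bregman ψ X y x') + a / 2 * ‖g‖ ^ 2 := by
  have h1 := h.optimality hψ hψc.1 ha hy
  have h3 := half_sq_norm_le_bregman hψ hψc h.1 hx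
  have h4 : fderivWithin ℝ ψ X x (y - x) =
      fderivWithin ℝ ψ X x (y - x') + fderivWithin ℝ ψ X x (x' - x) := by
    rw [← map_add]; congr 1; abel
  have h5 : g (x - x') ≤ ‖g‖ * ‖x' - x‖ := by
    rw [norm_sub_rev]; exact (le_abs_self _).trans (g.le_opNorm _)
  have h6 : g (x - y) = g (x - x') - g (y - x') := by
    rw [← map_sub]; congr 1; abel
  have h7 := mul_le_mul_of_nonneg_left h5 ha.le
  -- Optimality and the three-point identity give `-a * g (y - x') ≤ D(y, x) - D(y, x') - D(x', x)`.
  -- The term `-D(x', x) ≤ -‖x' - x‖² / 2` absorbs `a * g (x - x')` by Young's inequality.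
  have h8 : a * g (x - y) ≤ bregman ψ X y x - bregman ψ X y x' + a ^ 2 / 2 * ‖g‖ ^ 2 := by
    rw [h6]
    unfold bregman at h3 ⊢
    rw [h4]
    nlinarith [sq_nonneg (a * ‖g‖ - ‖x' - x‖)]
  have h9 := mul_le_mul_of_nonneg_left h8 (by positivity : 0 ≤ 1 / a)
  have h10 : 1 / a * (a * g (x - y)) = g (x - y) := by field_simp
  have h11 : 1 / a * (bregman ψ X y x - bregman ψ X y x' + a ^ 2 / 2 * ‖g‖ ^ 2)
    = (1 / a) * (bregman ψ X y x - bregman ψ X y x') + a / 2 * ‖g‖ ^ 2 := by field_simp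
  linarith

/-- Telescoping: `1 / √(N + 1) ≤ 2 * (√(N + 1) - √N)`. -/
theorem sum_inv_sqrt_le (N : ℕ) :
    ∑ s ∈ Finset.range N, 1 / √((s : ℝ) + 1) ≤ 2 * √(N : ℝ) := by
  induction N with
  | zero => simp
  | succ N ih =>
    rw [Finset.sum_range_succ]
    push_cast
    have hN : (0 : ℝ) ≤ N := Nat.cast_nonneg N
    have h1 : (0 : ℝ) < √((N : ℝ) + 1) := Real.sqrt_pos.2 (by linarith)
    have h2 : √(N : ℝ) ^ 2 = N := Real.sq_sqrt hN
    have h3 : √((N : ℝ) + 1) ^ 2 = N + 1 := Real.sq_sqrt (by linarith)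
    have h4 : 1 / √((N : ℝ) + 1) ≤ 2 * (√((N : ℝ) + 1) - √(N : ℝ)) := by
      rw [div_le_iff₀ h1]
      nlinarith [sq_nonneg (√((N : ℝ) + 1) - √(N : ℝ))]
    linarith

/-- Regret of mirror descent with step sizes `a / √t` over the rounds `p, …, p + N - 1`. -/
theorem sum_regret_le (hψ : DifferentiableOn ℝ ψ X) (hψc : StrongConvexOn X 1 ψ)
    {R G : ℝ} (hD : ∀ x ∈ X, ∀ y ∈ X, bregman ψ X x y ≤ 1 / 2 * R ^ 2) (ha : 0 < a)
    {x : ℕ → E} {g : ℕ → E →L[ℝ] ℝ} (hx : ∀ t, 1 ≤ t → x t ∈ X) (hg : ∀ t, 1 ≤ t → ‖g t‖ ≤ G)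
    (hstep : ∀ t : ℕ, 1 ≤ t → IsMirrorStep ψ X (a / √(t : ℝ)) (g t) (x t) (x (t + 1)))
    {p : ℕ} (hp : 1 ≤ p) {y : E} (hy : y ∈ X) (N : ℕ) :
    ∑ s ∈ Finset.range N, g (s + p) (x (s + p) - y)
      ≤ √((N + p - 1 : ℕ) : ℝ) / a * (1 / 2 * R ^ 2) + a * G ^ 2 * √(N : ℝ) := by
  have hpos : ∀ t : ℕ, 1 ≤ t → 0 < √(t : ℝ) := fun t ht =>
    Real.sqrt_pos.2 (by exact_mod_cast ht)
  -- Summation by parts as an induction: the left side keeps the last divergence, weighted by the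
  -- inverse of the previous step size. The weights increase and each divergence is at most `R ^ 2 /
  -- 2`, so their increments telescope to the final weight.
  have key : ∑ s ∈ Finset.range N, g (s + p) (x (s + p) - y)
      + √((N + p - 1 : ℕ) : ℝ) / a * bregman ψ X y (x (N + p))
      ≤ √((N + p - 1 : ℕ) : ℝ) / a * (1 / 2 * R ^ 2)
        + a * G ^ 2 / 2 * ∑ s ∈ Finset.range N, 1 / √((s : ℝ) + 1) := by
    induction N with
    | zero =>
      simp only [Finset.range_zero, Finset.sum_empty, zero_add, mul_zero, add_zero]
      have := hD y hy (x p) (hx p hp)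
      gcongr
    | succ N ih =>
      rw [Finset.sum_range_succ, Finset.sum_range_succ]
      have hNp : 1 ≤ N + p := by omega
      have hxN := hx _ hNp
      have h1 := (hstep _ hNp).regret_le hψ hψc (div_pos ha (hpos _ hNp)) hxN hy
      have h2 : 1 / (a / √((N + p : ℕ) : ℝ)) = √((N + p : ℕ) : ℝ) / a := by
        have := (hpos _ hNp).ne'
        field_simp
      rw [h2] at h1
      have h3 : a / √((N + p : ℕ) : ℝ) / 2 * ‖g (N + p)‖ ^ 2
          ≤ a * G ^ 2 / 2 * (1 / √((N : ℝ) + 1)) := by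
        have h5 : √((N : ℝ) + 1) ≤ √((N + p : ℕ) : ℝ) := by
          apply Real.sqrt_le_sqrt; push_cast
          have : (1 : ℝ) ≤ p := by exact_mod_cast hp
          linarith
        have h6 : 0 < √((N : ℝ) + 1) := Real.sqrt_pos.2 (by positivity)
        calc a / √((N + p : ℕ) : ℝ) / 2 * ‖g (N + p)‖ ^ 2
            ≤ a / √((N : ℝ) + 1) / 2 * G ^ 2 := by
              gcongr; exact hg _ hNp
          _ = _ := by ring
      have h7 : √((N + p - 1 : ℕ) : ℝ) ≤ √((N + p : ℕ) : ℝ) := by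
        apply Real.sqrt_le_sqrt; exact_mod_cast Nat.sub_le _ _
      have h8 : (√((N + p : ℕ) : ℝ) / a - √((N + p - 1 : ℕ) : ℝ) / a) *
          bregman ψ X y (x (N + p)) ≤ (√((N + p : ℕ) : ℝ) / a - √((N + p - 1 : ℕ) : ℝ) / a) *
          (1 / 2 * R ^ 2) :=
        mul_le_mul_of_nonneg_left (hD y hy _ hxN) (by rw [sub_nonneg]; gcongr)
      have h9 : N + 1 + p - 1 = N + p := by omega
      have h10 : N + 1 + p = N + p + 1 := by omega
      rw [h9, h10]
      linarith
  have h1 : 0 ≤ √((N + p - 1 : ℕ) : ℝ) / a * bregman ψ X y (x (N + p)) := by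
    have := half_sq_norm_le_bregman hψ hψc hy (hx (N + p) (by omega))
    have : 0 ≤ bregman ψ X y (x (N + p)) := le_trans (by positivity) this
    positivity
  have h2 := mul_le_mul_of_nonneg_left (sum_inv_sqrt_le N) (by positivity : 0 ≤ a * G ^ 2 / 2)
  linarith

/-- The iterates drift slowly. -/
theorem norm_iterate_sub_le (hψ : DifferentiableOn ℝ ψ X) (hψc : StrongConvexOn X 1 ψ)
    {G : ℝ} (ha : 0 < a)
    {x : ℕ → E} {g : ℕ → E →L[ℝ] ℝ} (hx : ∀ t, 1 ≤ t → x t ∈ X) (hg : ∀ t, 1 ≤ t → ‖g t‖ ≤ G)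
    (hstep : ∀ t : ℕ, 1 ≤ t → IsMirrorStep ψ X (a / √(t : ℝ)) (g t) (x t) (x (t + 1)))
    (s r : ℕ) : ‖x (s + 1) - x (s + 1 + r)‖ ≤ r * (a * G * (1 / √((s : ℝ) + 1))) := by
  induction r with
  | zero => simp
  | succ r ih =>
    have ht : 1 ≤ s + 1 + r := by omega
    have h0 : 0 < √((s + 1 + r : ℕ) : ℝ) := Real.sqrt_pos.2 (by exact_mod_cast ht)
    have h1 := (hstep _ ht).norm_sub_le hψ hψc (div_pos ha h0) (hx _ ht)
    have h2 : a / √((s + 1 + r : ℕ) : ℝ) * ‖g (s + 1 + r)‖ ≤ a * G * (1 / √((s : ℝ) + 1)) := by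
      have h3 : √((s : ℝ) + 1) ≤ √((s + 1 + r : ℕ) : ℝ) := by
        apply Real.sqrt_le_sqrt; push_cast
        linarith [(Nat.cast_nonneg r : (0 : ℝ) ≤ r)]
      have h4 : 0 < √((s : ℝ) + 1) := Real.sqrt_pos.2 (by positivity)
      calc a / √((s + 1 + r : ℕ) : ℝ) * ‖g (s + 1 + r)‖ ≤ a / √((s : ℝ) + 1) * G := by
            gcongr; exact hg _ ht
        _ = _ := by ring
    rw [norm_sub_rev] at h1
    have h5 := norm_sub_le_norm_sub_add_norm_sub (x (s + 1)) (x (s + 1 + r)) (x (s + 1 + r + 1))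
    rw [show s + 1 + (r + 1) = s + 1 + r + 1 by ring]
    push_cast
    linarith

end MirrorStep

/-! ### Spectral gap of `𝔼[QᵀQ]` and mixing of the mean matrix. -/

section Matrix

variable {n : ℕ}

/-- `eigenvalues` is `eigenvalues₀` carried along an equivalence of index types, so the exceptional
index is the image of position `0`. -/
theorem eigenvalues_le_secondEigenvalue (hn : 2 ≤ n) {A : Matrix (Fin n) (Fin n) ℝ}
    (hA : A.IsHermitian) :
    ∃ i₀, ∀ i, i ≠ i₀ → hA.eigenvalues i ≤ secondEigenvalue hn A hA := by
  have hc : 0 < Fintype.card (Fin n) := by rw [Fintype.card_fin]; omega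
  refine ⟨Fintype.equivOfCardEq (Fintype.card_fin _) ⟨0, hc⟩, fun i hi => ?_⟩
  refine hA.eigenvalues₀_antitone ?_
  rw [Fin.le_def]
  rw [ne_eq, ← Equiv.symm_apply_eq, Fin.ext_iff] at hi
  exact Nat.one_le_iff_ne_zero.2 hi

/-- Since `A *ᵥ 1 = 1`, every eigenvector with eigenvalue below `1` is orthogonal to the constants.
That covers all but one of the basis, so the remaining eigenvector spans the constants and is
orthogonal to `v`; only eigenvalues up to the second largest occur in the expansion of `v`. -/
theorem dotProduct_mulVec_le_secondEigenvalue (hn : 2 ≤ n) {A : Matrix (Fin n) (Fin n) ℝ}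
    (hA : A.IsHermitian) (h1 : A *ᵥ 1 = 1) (hlt : secondEigenvalue hn A hA < 1)
    {v : Fin n → ℝ} (hv : ∑ i, v i = 0) :
    v ⬝ᵥ A *ᵥ v ≤ secondEigenvalue hn A hA * (v ⬝ᵥ v) := by
  obtain ⟨i₀, hi₀⟩ := eigenvalues_le_secondEigenvalue hn hA
  set b := hA.eigenvectorBasis
  have parseval : ∀ x y : Fin n → ℝ, ∑ i, (⇑(b i) ⬝ᵥ x) * (⇑(b i) ⬝ᵥ y) = x ⬝ᵥ y := by
    intro x y
    have h := b.sum_inner_mul_inner (WithLp.toLp 2 x) (WithLp.toLp 2 y)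
    simp only [EuclideanSpace.inner_eq_star_dotProduct, star_trivial] at h
    rw [dotProduct_comm x y, ← h]
    refine Finset.sum_congr rfl fun i _ => ?_
    rw [dotProduct_comm y]
  have heig : ∀ i x, ⇑(b i) ⬝ᵥ A *ᵥ x = hA.eigenvalues i * (⇑(b i) ⬝ᵥ x) := by
    intro i x
    have hs : Aᵀ = A := by simpa [Matrix.IsHermitian] using hA
    rw [Matrix.dotProduct_mulVec, ← Matrix.mulVec_transpose, hs, hA.mulVec_eigenvectorBasis,
      smul_dotProduct, smul_eq_mul]
  have horth : ∀ i, i ≠ i₀ → ⇑(b i) ⬝ᵥ (1 : Fin n → ℝ) = 0 := by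
    intro i hi
    have h := heig i 1
    rw [h1] at h
    have h2 : hA.eigenvalues i < 1 := (hi₀ i hi).trans_lt hlt
    nlinarith
  have hsum : ∀ f : Fin n → ℝ, (∀ i, i ≠ i₀ → f i = 0) → ∑ i, f i = f i₀ := fun f hf =>
    Finset.sum_eq_single i₀ (fun i _ hi => hf i hi) (by simp)
  -- Otherwise the constant vector would be orthogonal to the whole basis, and Parseval would give
  -- `n = 0`.
  have hne : ⇑(b i₀) ⬝ᵥ (1 : Fin n → ℝ) ≠ 0 := by
    intro h0
    have h := parseval 1 1
    rw [hsum _ fun i hi => by rw [horth i hi, zero_mul], h0] at h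
    have h2 : (n : ℝ) = 0 := by simpa [dotProduct] using h.symm
    have h3 : n = 0 := by exact_mod_cast h2
    omega
  have hv0 : ⇑(b i₀) ⬝ᵥ v = 0 := by
    have h := parseval 1 v
    rw [hsum _ fun i hi => by rw [horth i hi, zero_mul]] at h
    have h2 : (1 : Fin n → ℝ) ⬝ᵥ v = 0 := by simpa [dotProduct] using hv
    rw [h2] at h
    exact (mul_eq_zero.1 h).resolve_left hne
  rw [← parseval v (A *ᵥ v), ← parseval v v, Finset.mul_sum]
  refine Finset.sum_le_sum fun i _ => ?_
  rw [heig]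
  by_cases hi : i = i₀
  · rw [hi, hv0]; simp
  · nlinarith [hi₀ i hi, mul_self_nonneg (⇑(b i) ⬝ᵥ v)]

theorem secondEigenvalue_nonneg (hn : 2 ≤ n) {A : Matrix (Fin n) (Fin n) ℝ}
    (hA : A.IsHermitian) (hp : A.PosSemidef) : 0 ≤ secondEigenvalue hn A hA := by
  have h := hp.eigenvalues_nonneg (Fintype.equivOfCardEq (Fintype.card_fin _)
    ⟨1, by rw [Fintype.card_fin]; omega⟩)
  simpa [Matrix.IsHermitian.eigenvalues] using! h

variable {Ω : Type*} [MeasurableSpace Ω] {μ : Measure Ω} [IsProbabilityMeasure μ]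
  {Q : Ω → Matrix (Fin n) (Fin n) ℝ}

/-- The mean `𝔼[Q]` of a random matrix `Q`. -/
noncomputable def meanMatrix (μ : Measure Ω) (Q : Ω → Matrix (Fin n) (Fin n) ℝ) :
    Matrix (Fin n) (Fin n) ℝ :=
  Matrix.of fun i j => ∫ ω, Q ω i j ∂μ

theorem integrable_entry (hm : ∀ i j, Measurable fun ω => Q ω i j)
    (hds : ∀ᵐ ω ∂μ, Q ω ∈ doublyStochastic ℝ (Fin n)) (i j : Fin n) :
    Integrable (fun ω => Q ω i j) μ := by
  refine Integrable.of_bound (hm i j).aestronglyMeasurable 1 ?_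
  filter_upwards [hds] with ω hω
  rw [Real.norm_eq_abs, abs_of_nonneg (nonneg_of_mem_doublyStochastic hω)]
  exact le_one_of_mem_doublyStochastic hω

theorem integrable_gram_entry (hm : ∀ i j, Measurable fun ω => Q ω i j)
    (hds : ∀ᵐ ω ∂μ, Q ω ∈ doublyStochastic ℝ (Fin n)) (i j : Fin n) :
    Integrable (fun ω => ((Q ω)ᵀ * Q ω) i j) μ := by
  simp only [Matrix.mul_apply, Matrix.transpose_apply]
  refine integrable_finsetSum _ fun k _ => ?_
  refine (integrable_entry hm hds k j).bdd_mul (c := 1) (hm k i).aestronglyMeasurable ?_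
  filter_upwards [hds] with ω hω
  rw [Real.norm_eq_abs, abs_of_nonneg (nonneg_of_mem_doublyStochastic hω)]
  exact le_one_of_mem_doublyStochastic hω

theorem meanMatrix_mem_doublyStochastic (hm : ∀ i j, Measurable fun ω => Q ω i j)
    (hds : ∀ᵐ ω ∂μ, Q ω ∈ doublyStochastic ℝ (Fin n)) :
    meanMatrix μ Q ∈ doublyStochastic ℝ (Fin n) := by
  have hint := integrable_entry hm hds
  rw [mem_doublyStochastic_iff_sum]
  refine ⟨fun i j => integral_nonneg_of_ae ?_, fun i => ?_, fun j => ?_⟩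
  · filter_upwards [hds] with ω hω using nonneg_of_mem_doublyStochastic hω
  · simp only [meanMatrix, Matrix.of_apply]
    rw [← integral_finsetSum _ fun j _ => hint i j]
    have : (fun ω => ∑ j, Q ω i j) =ᵐ[μ] fun _ => 1 := by
      filter_upwards [hds] with ω hω using sum_row_of_mem_doublyStochastic hω i
    rw [integral_congr_ae this]; simp
  · simp only [meanMatrix, Matrix.of_apply]
    rw [← integral_finsetSum _ fun i _ => hint i j]
    have : (fun ω => ∑ i, Q ω i j) =ᵐ[μ] fun _ => 1 := by
      filter_upwards [hds] with ω hω using sum_col_of_mem_doublyStochastic hω j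
    rw [integral_congr_ae this]; simp

theorem expectedGram_mulVec_one (hm : ∀ i j, Measurable fun ω => Q ω i j)
    (hds : ∀ᵐ ω ∂μ, Q ω ∈ doublyStochastic ℝ (Fin n)) : expectedGram μ Q *ᵥ 1 = 1 := by
  ext i
  simp only [Matrix.mulVec, dotProduct, expectedGram, Matrix.of_apply, Pi.one_apply, mul_one]
  rw [← integral_finsetSum _ fun j _ => integrable_gram_entry hm hds i j]
  have : (fun ω => ∑ j, ((Q ω)ᵀ * Q ω) i j) =ᵐ[μ] fun _ => 1 := by
    filter_upwards [hds] with ω hω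
    exact sum_row_of_mem_doublyStochastic
      (mul_mem (transpose_mem_doublyStochastic_iff.2 hω) hω) i
  rw [integral_congr_ae this]; simp

theorem dotProduct_expectedGram_mulVec (hm : ∀ i j, Measurable fun ω => Q ω i j)
    (hds : ∀ᵐ ω ∂μ, Q ω ∈ doublyStochastic ℝ (Fin n)) (v : Fin n → ℝ) :
    Integrable (fun ω => (Q ω *ᵥ v) ⬝ᵥ (Q ω *ᵥ v)) μ ∧
    v ⬝ᵥ expectedGram μ Q *ᵥ v = ∫ ω, (Q ω *ᵥ v) ⬝ᵥ (Q ω *ᵥ v) ∂μ := by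
  have hint := integrable_gram_entry hm hds
  have h1 : ∀ ω, (Q ω *ᵥ v) ⬝ᵥ (Q ω *ᵥ v) = ∑ i, ∑ j, v i * (((Q ω)ᵀ * Q ω) i j * v j) := by
    intro ω
    rw [Matrix.dotProduct_mulVec, ← Matrix.mulVec_transpose, Matrix.mulVec_mulVec,
      dotProduct_comm]
    simp only [dotProduct, Matrix.mulVec, Finset.mul_sum]
  have h2 : ∀ i j, Integrable (fun ω => v i * (((Q ω)ᵀ * Q ω) i j * v j)) μ := fun i j =>
    ((hint i j).mul_const _).const_mul _
  simp_rw [h1]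
  refine ⟨integrable_finsetSum _ fun i _ => integrable_finsetSum _ fun j _ => h2 i j, ?_⟩
  rw [integral_finsetSum _ fun i _ => integrable_finsetSum _ fun j _ => h2 i j]
  simp only [dotProduct, Matrix.mulVec, Finset.mul_sum]
  refine Finset.sum_congr rfl fun i _ => ?_
  rw [integral_finsetSum _ fun j _ => h2 i j]
  refine Finset.sum_congr rfl fun j _ => ?_
  rw [integral_const_mul, integral_mul_const]
  rfl

theorem expectedGram_posSemidef (hm : ∀ i j, Measurable fun ω => Q ω i j)
    (hds : ∀ᵐ ω ∂μ, Q ω ∈ doublyStochastic ℝ (Fin n)) : (expectedGram μ Q).PosSemidef := by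
  refine Matrix.PosSemidef.of_dotProduct_mulVec_nonneg (expectedGram_isHermitian μ Q) fun v => ?_
  rw [star_trivial, (dotProduct_expectedGram_mulVec hm hds v).2]
  exact integral_nonneg fun ω => by simpa using dotProduct_star_self_nonneg (Q ω *ᵥ v)

theorem lambdaTwo_nonneg (hn : 2 ≤ n) (hm : ∀ i j, Measurable fun ω => Q ω i j)
    (hds : ∀ᵐ ω ∂μ, Q ω ∈ doublyStochastic ℝ (Fin n)) : 0 ≤ lambdaTwo hn μ Q :=
  secondEigenvalue_nonneg hn _ (expectedGram_posSemidef hm hds)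

/-- Jensen's inequality for the squared norm. This lets `λ₂(𝔼[QᵀQ])` control the token, whose
averaged motion involves only `𝔼[Q]`. -/
theorem meanMatrix_mulVec_sq_le (hm : ∀ i j, Measurable fun ω => Q ω i j)
    (hds : ∀ᵐ ω ∂μ, Q ω ∈ doublyStochastic ℝ (Fin n)) (v : Fin n → ℝ) :
    (meanMatrix μ Q *ᵥ v) ⬝ᵥ (meanMatrix μ Q *ᵥ v) ≤ v ⬝ᵥ expectedGram μ Q *ᵥ v := by
  obtain ⟨hi, he⟩ := dotProduct_expectedGram_mulVec hm hds v
  set w := meanMatrix μ Q *ᵥ v with hw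
  have hint : ∀ i, Integrable (fun ω => (Q ω *ᵥ v) i) μ := fun i => by
    simp only [Matrix.mulVec, dotProduct]
    exact integrable_finsetSum _ fun j _ => (integrable_entry hm hds i j).mul_const _
  have hmean : ∀ i, ∫ ω, (Q ω *ᵥ v) i ∂μ = w i := fun i => by
    simp only [Matrix.mulVec, dotProduct, hw, meanMatrix, Matrix.of_apply]
    rw [integral_finsetSum _ fun j _ => (integrable_entry hm hds i j).mul_const _]
    simp_rw [integral_mul_const]
  have hcross : Integrable (fun ω => w ⬝ᵥ Q ω *ᵥ v) μ ∧ ∫ ω, w ⬝ᵥ Q ω *ᵥ v ∂μ = w ⬝ᵥ w := by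
    simp only [dotProduct]
    refine ⟨integrable_finsetSum _ fun i _ => (hint i).const_mul _, ?_⟩
    rw [integral_finsetSum _ fun i _ => (hint i).const_mul _]
    simp_rw [integral_const_mul, hmean]
  -- Integrates `0 ≤ ‖Q v - w‖²` with `w = 𝔼[Q] v`.
  have hle : ∫ ω, (2 * (w ⬝ᵥ Q ω *ᵥ v) - w ⬝ᵥ w) ∂μ ≤ ∫ ω, (Q ω *ᵥ v) ⬝ᵥ (Q ω *ᵥ v) ∂μ := by
    refine integral_mono ((hcross.1.const_mul 2).sub (integrable_const _)) hi fun ω => ?_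
    have h := dotProduct_star_self_nonneg (Q ω *ᵥ v - w)
    simp only [star_trivial, sub_dotProduct, dotProduct_sub] at h
    have hc := dotProduct_comm w (Q ω *ᵥ v)
    simp only
    linarith
  rw [integral_sub (hcross.1.const_mul 2) (integrable_const _), integral_const_mul, hcross.2] at hle
  simp only [integral_const, probReal_univ, one_smul] at hle
  rw [he]
  linarith

/-- The powers of the mean matrix contract the vectors with mean zero. -/
theorem meanMatrix_pow_mulVec_sq_le (hn : 2 ≤ n) (hm : ∀ i j, Measurable fun ω => Q ω i j)
    (hds : ∀ᵐ ω ∂μ, Q ω ∈ doublyStochastic ℝ (Fin n)) (hlt : lambdaTwo hn μ Q < 1)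
    {v : Fin n → ℝ} (hv : ∑ i, v i = 0) (k : ℕ) :
    (meanMatrix μ Q ^ k *ᵥ v) ⬝ᵥ (meanMatrix μ Q ^ k *ᵥ v) ≤ lambdaTwo hn μ Q ^ k * (v ⬝ᵥ v) := by
  induction k generalizing v with
  | zero => simp
  | succ k ih =>
    have hv' : ∑ i, (meanMatrix μ Q *ᵥ v) i = 0 := by
      rw [sum_mulVec_of_mem_doublyStochastic (meanMatrix_mem_doublyStochastic hm hds), hv]
    have h1 := ih hv'
    rw [Matrix.mulVec_mulVec, ← pow_succ] at h1
    have h2 := (meanMatrix_mulVec_sq_le hm hds v).trans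
      (dotProduct_mulVec_le_secondEigenvalue hn (expectedGram_isHermitian μ Q)
        (expectedGram_mulVec_one hm hds) hlt hv)
    have h3 := mul_le_mul_of_nonneg_left h2 (pow_nonneg (lambdaTwo_nonneg hn hm hds) k)
    refine h1.trans (h3.trans_eq ?_)
    rw [pow_succ, mul_assoc]
    rfl

/-- Mixing of the mean chain: its `k`-step averages of a bounded vector approach the mean. -/
theorem abs_meanMatrix_pow_mulVec_sub_le (hn : 2 ≤ n) (hm : ∀ i j, Measurable fun ω => Q ω i j)
    (hds : ∀ᵐ ω ∂μ, Q ω ∈ doublyStochastic ℝ (Fin n)) (hlt : lambdaTwo hn μ Q < 1)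
    {v : Fin n → ℝ} {c : ℝ} (hv : ∀ i, |v i| ≤ c) (k : ℕ) (i : Fin n) :
    |(meanMatrix μ Q ^ k *ᵥ v) i - 1 / (n : ℝ) * ∑ j, v j|
      ≤ √(n * lambdaTwo hn μ Q ^ k) * c := by
  have hn0 : (0 : ℝ) < n := by exact_mod_cast (by omega : 0 < n)
  have hc : 0 ≤ c := (abs_nonneg _).trans (hv i)
  set b : ℝ := 1 / (n : ℝ) * ∑ j, v j with hb
  set w : Fin n → ℝ := v - b • 1 with hw
  have hnb : n * b = ∑ j, v j := by rw [hb]; field_simp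
  have hw0 : ∑ j, w j = 0 := by
    simp [hw, Finset.sum_sub_distrib, hnb]
  have hpow : meanMatrix μ Q ^ k ∈ doublyStochastic ℝ (Fin n) :=
    pow_mem (meanMatrix_mem_doublyStochastic hm hds) k
  have hMw : meanMatrix μ Q ^ k *ᵥ w = meanMatrix μ Q ^ k *ᵥ v - b • 1 := by
    rw [hw, Matrix.mulVec_sub, Matrix.mulVec_smul, mulVec_one_of_mem_doublyStochastic hpow]
  have hi : (meanMatrix μ Q ^ k *ᵥ v) i - b = (meanMatrix μ Q ^ k *ᵥ w) i := by
    rw [hMw]; simp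
  -- Centring only lowers the Euclidean norm, which for entries bounded by `c` is at most `√n * c`;
  -- this is the source of the factor `n` under the root.
  have hww : w ⬝ᵥ w ≤ n * c ^ 2 := by
    have h1 : w ⬝ᵥ w = v ⬝ᵥ v - n * b ^ 2 := by
      have h2 : v ⬝ᵥ (1 : Fin n → ℝ) = n * b := by rw [hnb]; simp [dotProduct]
      have h3 : (1 : Fin n → ℝ) ⬝ᵥ (1 : Fin n → ℝ) = n := by simp [dotProduct]
      simp only [hw, sub_dotProduct, dotProduct_sub, smul_dotProduct, dotProduct_smul, h3, h2,
        dotProduct_comm 1 v, smul_eq_mul]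
      ring
    have h2 : v ⬝ᵥ v ≤ n * c ^ 2 := by
      calc v ⬝ᵥ v = ∑ j, v j ^ 2 := Finset.sum_congr rfl fun j _ => by ring
        _ ≤ ∑ _j : Fin n, c ^ 2 := Finset.sum_le_sum fun j _ => sq_le_sq'
            (by linarith [(abs_le.1 (hv j)).1]) (abs_le.1 (hv j)).2
        _ = n * c ^ 2 := by simp
    have h3 : 0 ≤ n * b ^ 2 := by positivity
    linarith
  have hlam := lambdaTwo_nonneg hn hm hds
  have h1 : (meanMatrix μ Q ^ k *ᵥ w) i ^ 2 ≤ n * lambdaTwo hn μ Q ^ k * c ^ 2 := by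
    calc (meanMatrix μ Q ^ k *ᵥ w) i ^ 2
        ≤ ∑ j, (meanMatrix μ Q ^ k *ᵥ w) j ^ 2 :=
          Finset.single_le_sum (f := fun j => (meanMatrix μ Q ^ k *ᵥ w) j ^ 2)
            (fun j _ => sq_nonneg _) (Finset.mem_univ i)
      _ = (meanMatrix μ Q ^ k *ᵥ w) ⬝ᵥ (meanMatrix μ Q ^ k *ᵥ w) :=
          Finset.sum_congr rfl fun j _ => by ring
      _ ≤ lambdaTwo hn μ Q ^ k * (w ⬝ᵥ w) := meanMatrix_pow_mulVec_sq_le hn hm hds hlt hw0 k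
      _ ≤ lambdaTwo hn μ Q ^ k * (n * c ^ 2) := by gcongr
      _ = _ := by ring
  rw [hi, ← Real.sqrt_sq hc, ← Real.sqrt_mul (by positivity), ← Real.sqrt_sq_eq_abs]
  exact Real.sqrt_le_sqrt h1

end Matrix

/-! ### A Hoeffding–Azuma inequality for conditional means taken with a lag. -/

section Concentration

/-- The left side is the moment generating function at `s` of the law on `{-1, 1}` with mean `t`, so
this is Hoeffding's lemma with variance proxy `1`. It bounds the chord of the exponential after a
bounded variable has been replaced by its conditional mean. -/
theorem cosh_add_mul_sinh_le_exp {t : ℝ} (ht : |t| ≤ 1) (s : ℝ) :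
    Real.cosh s + t * Real.sinh s ≤ Real.exp (s * t + s ^ 2 / 2) := by
  obtain ⟨h1, h2⟩ := abs_le.1 ht
  let ν : Measure ℝ := ENNReal.ofReal ((1 + t) / 2) • Measure.dirac 1 +
    ENNReal.ofReal ((1 - t) / 2) • Measure.dirac (-1)
  have hν : IsProbabilityMeasure ν := ⟨by
    simp only [ν, Measure.add_apply, Measure.smul_apply, measure_univ, smul_eq_mul, mul_one]
    rw [← ENNReal.ofReal_add (by linarith) (by linarith), ← ENNReal.ofReal_one]
    congr 1; ring⟩
  have hint : ∀ f : ℝ → ℝ, ∫ x, f x ∂ν = (1 + t) / 2 * f 1 + (1 - t) / 2 * f (-1) := by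
    intro f
    rw [integral_add_measure, integral_smul_measure, integral_smul_measure, integral_dirac,
      integral_dirac, ENNReal.toReal_ofReal (by linarith), ENNReal.toReal_ofReal (by linarith),
      smul_eq_mul, smul_eq_mul]
    · exact (integrable_dirac (by simp)).smul_measure ENNReal.ofReal_ne_top
    · exact (integrable_dirac (by simp)).smul_measure ENNReal.ofReal_ne_top
  have hb : ∀ᵐ x ∂ν, id x ∈ Set.Icc (-1 : ℝ) 1 := by
    simp only [ν, id]
    rw [ae_add_measure_iff]
    constructor
    · exact Measure.ae_smul_measure ((ae_dirac_iff (p := fun x => x ∈ Set.Icc (-1 : ℝ) 1)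
        measurableSet_Icc).2 (by norm_num)) _
    · exact Measure.ae_smul_measure ((ae_dirac_iff (p := fun x => x ∈ Set.Icc (-1 : ℝ) 1)
        measurableSet_Icc).2 (by norm_num)) _
  have h := (hasSubgaussianMGF_of_mem_Icc (μ := ν) (X := id) aemeasurable_id hb).mgf_le s
  have hmean : ∫ x, id x ∂ν = t := by rw [hint]; simp only [id]; ring
  rw [hmean, mgf, hint] at h
  simp only [id] at h
  have hpar : (((‖(1 : ℝ) - -1‖₊ / 2) ^ 2 : NNReal) : ℝ) = 1 := by
    push_cast; norm_num
  rw [hpar, one_mul] at h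
  have h3 := mul_le_mul_of_nonneg_right h (Real.exp_pos (s * t)).le
  rw [← Real.exp_add] at h3
  have h4 : Real.exp (s * (1 - t)) * Real.exp (s * t) = Real.exp s := by
    rw [← Real.exp_add]; congr 1; ring
  have h5 : Real.exp (s * (-1 - t)) * Real.exp (s * t) = Real.exp (-s) := by
    rw [← Real.exp_add]; congr 1; ring
  rw [add_mul, mul_assoc, mul_assoc, h4, h5, add_comm (s ^ 2 / 2)] at h3
  rw [Real.cosh_eq, Real.sinh_eq]
  linarith

variable {Ω : Type*} {m m0 : MeasurableSpace Ω} {μ : Measure Ω} [IsProbabilityMeasure μ]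

theorem integrable_of_abs_le {f : Ω → ℝ} (hf : Measurable f) {B : ℝ} (hB : ∀ ω, |f ω| ≤ B) :
    Integrable f μ :=
  Integrable.of_bound hf.aestronglyMeasurable B (Filter.Eventually.of_forall hB)

/-- Hoeffding's lemma for the conditional mean `m` of a bounded variable `Y`, tested against the
nonnegative weights `W` on which the conditional mean can be tested. -/
theorem integral_mul_exp_sub_le (hm : m ≤ m0) {c : ℝ} (hc : 0 < c)
    {Y M W : Ω → ℝ} (hY : Measurable Y) (hM : Measurable[m] M) (hYc : ∀ ω, |Y ω| ≤ c)
    (hMc : ∀ ω, |M ω| ≤ c)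
    (hcond : ∀ V : Ω → ℝ, Measurable[m] V → (∃ B, ∀ ω, |V ω| ≤ B) →
      ∫ ω, V ω * Y ω ∂μ = ∫ ω, V ω * M ω ∂μ)
    (hW : Measurable[m] W) (hW0 : ∀ ω, 0 ≤ W ω) {B : ℝ} (hWB : ∀ ω, W ω ≤ B) (θ : ℝ) :
    ∫ ω, W ω * Real.exp (θ * (Y ω - M ω)) ∂μ
      ≤ Real.exp (θ ^ 2 * c ^ 2 / 2) * ∫ ω, W ω ∂μ := by
  -- The factor `exp (-(θ * M))` is measurable for `m`, so it joins the weight and only `exp (θ *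
  -- Y)` remains.
  set V : Ω → ℝ := fun ω => W ω * Real.exp (-(θ * M ω)) with hV
  have hM' : Measurable M := hM.mono hm le_rfl
  have hW' : Measurable W := hW.mono hm le_rfl
  have hVm : Measurable[m] V := by
    exact hW.mul (Real.measurable_exp.comp ((hM.const_mul θ).neg))
  have hVm' : Measurable V := hVm.mono hm le_rfl
  have hθ : ∀ x : ℝ, |x| ≤ c → |θ * x| ≤ |θ| * c := fun x hx => by
    rw [abs_mul]; gcongr
  have hV0 : ∀ ω, 0 ≤ V ω := fun ω => mul_nonneg (hW0 ω) (Real.exp_pos _).le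
  have hVB : ∀ ω, |V ω| ≤ B * Real.exp (|θ| * c) := fun ω => by
    rw [abs_of_nonneg (hV0 ω)]
    refine mul_le_mul (hWB ω) (Real.exp_le_exp.2 ?_) (Real.exp_pos _).le
      ((hW0 ω).trans (hWB ω))
    exact (neg_le_abs _).trans (hθ _ (hMc ω))
  have hVint : Integrable V μ := integrable_of_abs_le hVm' hVB
  have hVY : Integrable (fun ω => V ω * Y ω) μ :=
    integrable_of_abs_le (B := B * Real.exp (|θ| * c) * c) (hVm'.mul hY) fun ω => by
      rw [abs_mul]
      exact mul_le_mul (hVB ω) (hYc ω) (abs_nonneg _) ((abs_nonneg _).trans (hVB ω))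
  have hVM : Integrable (fun ω => V ω * M ω) μ :=
    integrable_of_abs_le (B := B * Real.exp (|θ| * c) * c) (hVm'.mul hM') fun ω => by
      rw [abs_mul]
      exact mul_le_mul (hVB ω) (hMc ω) (abs_nonneg _) ((abs_nonneg _).trans (hVB ω))
  have hsplit : ∀ ω, W ω * Real.exp (θ * (Y ω - M ω)) = V ω * Real.exp (θ * Y ω) := fun ω => by
    rw [hV]; simp only; rw [mul_assoc, ← Real.exp_add]; congr 2; ring
  have hdiv : ∀ x : ℝ, |x| ≤ c → |x / c| ≤ 1 := fun x hx => by
    rw [abs_div, abs_of_pos hc, div_le_one hc]; exact hx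
  -- The chord of the exponential over `[-c, c]` is affine in `Y`, so `hcond` suffices to exchange
  -- `Y` for `M`; the next bound then returns from the chord to an exponential.
  have hup : ∀ ω, V ω * Real.exp (θ * Y ω)
      ≤ Real.cosh (θ * c) * V ω + Real.sinh (θ * c) / c * (V ω * Y ω) := fun ω => by
    have h := Real.exp_mul_le_cosh_add_mul_sinh (hdiv _ (hYc ω)) (θ * c)
    have h2 : Y ω / c * (θ * c) = θ * Y ω := by field_simp
    rw [h2] at h
    calc V ω * Real.exp (θ * Y ω)
        ≤ V ω * (Real.cosh (θ * c) + Y ω / c * Real.sinh (θ * c)) :=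
          mul_le_mul_of_nonneg_left h (hV0 ω)
      _ = _ := by ring
  have hlow : ∀ ω, Real.cosh (θ * c) * V ω + Real.sinh (θ * c) / c * (V ω * M ω)
      ≤ Real.exp (θ ^ 2 * c ^ 2 / 2) * W ω := fun ω => by
    have h := cosh_add_mul_sinh_le_exp (hdiv _ (hMc ω)) (θ * c)
    calc Real.cosh (θ * c) * V ω + Real.sinh (θ * c) / c * (V ω * M ω)
        = V ω * (Real.cosh (θ * c) + M ω / c * Real.sinh (θ * c)) := by ring
      _ ≤ V ω * Real.exp (θ * c * (M ω / c) + (θ * c) ^ 2 / 2) :=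
          mul_le_mul_of_nonneg_left h (hV0 ω)
      _ = W ω * Real.exp (θ ^ 2 * c ^ 2 / 2) := by
          rw [hV]; simp only; rw [mul_assoc, ← Real.exp_add]; congr 2; field_simp; ring
      _ = _ := mul_comm _ _
  have hWint : Integrable W μ := integrable_of_abs_le (B := B) hW' fun ω => by
    rw [abs_of_nonneg (hW0 ω)]; exact hWB ω
  have hExp : Integrable (fun ω => V ω * Real.exp (θ * Y ω)) μ :=
    integrable_of_abs_le (B := B * Real.exp (|θ| * c) * Real.exp (|θ| * c))
      (hVm'.mul (Real.measurable_exp.comp (hY.const_mul θ))) fun ω => by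
      rw [abs_mul, Real.abs_exp]
      exact mul_le_mul (hVB ω) (Real.exp_le_exp.2 ((le_abs_self _).trans (hθ _ (hYc ω))))
        (Real.exp_pos _).le ((abs_nonneg _).trans (hVB ω))
  calc ∫ ω, W ω * Real.exp (θ * (Y ω - M ω)) ∂μ = ∫ ω, V ω * Real.exp (θ * Y ω) ∂μ := by
        simp_rw [hsplit]
    _ ≤ ∫ ω, (Real.cosh (θ * c) * V ω + Real.sinh (θ * c) / c * (V ω * Y ω)) ∂μ :=
        integral_mono hExp ((hVint.const_mul _).add (hVY.const_mul _)) hup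
    _ = ∫ ω, (Real.cosh (θ * c) * V ω + Real.sinh (θ * c) / c * (V ω * M ω)) ∂μ := by
        rw [integral_add (hVint.const_mul _) (hVY.const_mul _), integral_const_mul,
          integral_const_mul, hcond V hVm ⟨_, hVB⟩,
          integral_add (hVint.const_mul _) (hVM.const_mul _), integral_const_mul,
          integral_const_mul]
    _ ≤ ∫ ω, Real.exp (θ ^ 2 * c ^ 2 / 2) * W ω ∂μ :=
        integral_mono ((hVint.const_mul _).add (hVM.const_mul _)) (hWint.const_mul _) hlow
    _ = _ := integral_const_mul _ _

/-- On one residue class `s ↦ s / p` is injective, with values below `⌈N / p⌉ = (N + p - 1) / p`. -/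
theorem card_filter_mod_eq_le {p : ℕ} (hp : 0 < p) (r N : ℕ) :
    p * ((Finset.range N).filter fun s => s % p = r).card ≤ N + p - 1 := by
  have h : ((Finset.range N).filter fun s => s % p = r).card ≤
      (Finset.range ((N + p - 1) / p)).card := by
    refine Finset.card_le_card_of_injOn (fun s => s / p) ?_ ?_
    · intro s hs
      simp only [Finset.coe_filter, Finset.mem_range, Set.mem_ofPred_eq] at hs
      simp only [Finset.coe_range, Set.mem_Iio]
      have h1 : s / p + 1 = (s + p) / p := (Nat.add_div_right s hp).symm
      have h2 : (s + p) / p ≤ (N + p - 1) / p := Nat.div_le_div_right (by omega)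
      omega
    · intro s hs t ht hst
      simp only [Finset.coe_filter, Finset.mem_range, Set.mem_ofPred_eq] at hs ht
      simp only at hst
      rw [← Nat.div_add_mod s p, ← Nat.div_add_mod t p, hst, hs.2, ht.2]
  rw [Finset.card_range] at h
  exact (Nat.mul_le_mul_left p h).trans (Nat.mul_div_le _ _)

variable {ℱ : ℕ → MeasurableSpace Ω} {p : ℕ} {c : ℝ} {Y M : ℕ → Ω → ℝ}

/-- Exponential moments of the sum over one residue class modulo the lag `p`. -/
theorem integral_exp_block_le (hmono : Monotone ℱ) (hle : ∀ s, ℱ s ≤ m0)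
    (hc : 0 < c) (hY : ∀ s, Measurable[ℱ (s + p)] (Y s)) (hM : ∀ s, Measurable[ℱ s] (M s))
    (hYc : ∀ s ω, |Y s ω| ≤ c) (hMc : ∀ s ω, |M s ω| ≤ c)
    (hcond : ∀ s, ∀ V : Ω → ℝ, Measurable[ℱ s] V → (∃ B, ∀ ω, |V ω| ≤ B) →
      ∫ ω, V ω * Y s ω ∂μ = ∫ ω, V ω * M s ω ∂μ) (r : ℕ) (θ : ℝ) (N : ℕ) :
    ∫ ω, Real.exp (θ * ∑ s ∈ (Finset.range N).filter (fun s => s % p = r), (Y s ω - M s ω)) ∂μ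
      ≤ Real.exp (θ ^ 2 * c ^ 2 / 2 *
          ((Finset.range N).filter fun s => s % p = r).card) := by
  induction N with
  | zero => simp
  | succ N ih =>
    rw [Finset.range_add_one, Finset.filter_insert]
    split_ifs with hr
    · have hnot : N ∉ (Finset.range N).filter fun s => s % p = r := by simp
      rw [Finset.card_insert_of_notMem hnot]
      simp_rw [Finset.sum_insert hnot]
      set S : Ω → ℝ := fun ω => ∑ s ∈ (Finset.range N).filter (fun s => s % p = r),
        (Y s ω - M s ω) with hS
      have hSm : Measurable[ℱ N] S := by
        refine @Finset.measurable_sum _ _ _ _ _ _ (ℱ N) _ _ fun s hs => ?_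
        simp only [Finset.mem_filter, Finset.mem_range] at hs
        -- Distinct members of a residue class are at least `p` apart, so every earlier difference
        -- in the class is already known at time `N`.
        have hsp : s + p ≤ N := by
          have h1 : s ≡ N [MOD p] := by rw [Nat.ModEq, hs.2, hr]
          have h2 := (Nat.modEq_iff_dvd' hs.1.le).1 h1
          have h3 := Nat.le_of_dvd (by omega) h2
          omega
        exact ((hY s).mono (hmono hsp) le_rfl).sub ((hM s).mono (hmono hs.1.le) le_rfl)
      have hSb : ∀ ω, |S ω| ≤ ∑ s ∈ (Finset.range N).filter (fun s => s % p = r), 2 * c :=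
        fun ω => (Finset.abs_sum_le_sum_abs _ _).trans (Finset.sum_le_sum fun s _ =>
          (abs_sub _ _).trans (by linarith [hYc s ω, hMc s ω]))
      have h := integral_mul_exp_sub_le (μ := μ) (hle N) hc
        (Y := Y N) ((hY N).mono (hle (N + p)) le_rfl) (hM N) (hYc N) (hMc N) (hcond N)
        (W := fun ω => Real.exp (θ * S ω))
        (Real.measurable_exp.comp (hSm.const_mul θ))
        (fun ω => (Real.exp_pos _).le)
        (B := Real.exp (|θ| * ∑ s ∈ (Finset.range N).filter (fun s => s % p = r), 2 * c))
        (fun ω => Real.exp_le_exp.2 ((le_abs_self _).trans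
          (by rw [abs_mul]; exact mul_le_mul_of_nonneg_left (hSb ω) (abs_nonneg _)))) θ
      calc ∫ ω, Real.exp (θ * (Y N ω - M N ω + S ω)) ∂μ
          = ∫ ω, Real.exp (θ * S ω) * Real.exp (θ * (Y N ω - M N ω)) ∂μ := by
            congr 1; ext ω; rw [← Real.exp_add]; congr 1; ring
        _ ≤ Real.exp (θ ^ 2 * c ^ 2 / 2) * ∫ ω, Real.exp (θ * S ω) ∂μ := h
        _ ≤ Real.exp (θ ^ 2 * c ^ 2 / 2) * Real.exp (θ ^ 2 * c ^ 2 / 2 *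
          ((Finset.range N).filter fun s => s % p = r).card) := by gcongr
        _ = _ := by rw [← Real.exp_add]; congr 1; push_cast; ring
    · exact ih

/-- Azuma's inequality for conditional means taken with a lag `p`. -/
theorem measure_sum_sub_ge_le (hmono : Monotone ℱ) (hle : ∀ s, ℱ s ≤ m0) (hp : 0 < p)
    (hc : 0 < c) (hY : ∀ s, Measurable[ℱ (s + p)] (Y s)) (hM : ∀ s, Measurable[ℱ s] (M s))
    (hYc : ∀ s ω, |Y s ω| ≤ c) (hMc : ∀ s ω, |M s ω| ≤ c)
    (hcond : ∀ s, ∀ V : Ω → ℝ, Measurable[ℱ s] V → (∃ B, ∀ ω, |V ω| ≤ B) →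
      ∫ ω, V ω * Y s ω ∂μ = ∫ ω, V ω * M s ω ∂μ) {N : ℕ} (hN : 0 < N) {γ : ℝ} (hγ : 0 ≤ γ) :
    μ.real {ω | γ ≤ ∑ s ∈ Finset.range N, (Y s ω - M s ω)}
      ≤ Real.exp (-(γ ^ 2 / (2 * (c ^ 2 * p * (N + p - 1 : ℕ))))) := by
  have hD : ∀ s, Measurable fun ω => Y s ω - M s ω := fun s =>
    ((hY s).mono (hle _) le_rfl).sub ((hM s).mono (hle _) le_rfl)
  have hDb : ∀ s ω, |Y s ω - M s ω| ≤ 2 * c := fun s ω =>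
    (abs_sub _ _).trans (by linarith [hYc s ω, hMc s ω])
  have hint : ∀ (A : Finset ℕ) (θ : ℝ),
      Integrable (fun ω => Real.exp (θ * ∑ s ∈ A, (Y s ω - M s ω))) μ := fun A θ => by
    refine integrable_of_abs_le (B := Real.exp (|θ| * ∑ s ∈ A, 2 * c))
      (Real.measurable_exp.comp ((Finset.measurable_sum _ fun s _ => hD s).const_mul θ))
      fun ω => ?_
    rw [Real.abs_exp, Real.exp_le_exp]
    refine (le_abs_self _).trans ?_
    rw [abs_mul]
    exact mul_le_mul_of_nonneg_left ((Finset.abs_sum_le_sum_abs _ _).trans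
      (Finset.sum_le_sum fun s _ => hDb s ω)) (abs_nonneg _)
  have hp0 : (0 : ℝ) < p := by exact_mod_cast hp
  have hL0 : (0 : ℝ) < ((N + p - 1 : ℕ) : ℝ) := by exact_mod_cast (by omega : 0 < N + p - 1)
  have hmgf : ∀ θ : ℝ, ∫ ω, Real.exp (θ * ∑ s ∈ Finset.range N, (Y s ω - M s ω)) ∂μ
      ≤ Real.exp (θ ^ 2 * (c ^ 2 * p * (N + p - 1 : ℕ)) / 2) := by
    intro θ
    -- The sum over all rounds is the average over the `p` classes of `p` times the class sum.
    -- Convexity of `exp` then requires nothing about dependence between classes; the price is the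
    -- parameter `p * θ`.
    have hjensen : ∀ ω, Real.exp (θ * ∑ s ∈ Finset.range N, (Y s ω - M s ω))
        ≤ ∑ r ∈ Finset.range p, 1 / (p : ℝ) * Real.exp (p * θ *
          ∑ s ∈ (Finset.range N).filter (fun s => s % p = r), (Y s ω - M s ω)) := by
      intro ω
      have h := convexOn_exp.map_sum_le (t := Finset.range p) (w := fun _ => 1 / (p : ℝ))
        (p := fun r => p * θ * ∑ s ∈ (Finset.range N).filter (fun s => s % p = r),
          (Y s ω - M s ω))
        (fun _ _ => by positivity) (by simp [hp0.ne']) (fun _ _ => Set.mem_univ _)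
      simp only [smul_eq_mul] at h
      refine (Real.exp_le_exp.2 (le_of_eq ?_)).trans h
      rw [← Finset.sum_fiberwise_of_maps_to (s := Finset.range N) (t := Finset.range p)
        (g := fun s => s % p) (fun s _ => Finset.mem_range.2 (Nat.mod_lt _ hp)), Finset.mul_sum]
      refine Finset.sum_congr rfl fun r _ => ?_
      field_simp
    calc ∫ ω, Real.exp (θ * ∑ s ∈ Finset.range N, (Y s ω - M s ω)) ∂μ
        ≤ ∫ ω, ∑ r ∈ Finset.range p, 1 / (p : ℝ) * Real.exp (p * θ *
          ∑ s ∈ (Finset.range N).filter (fun s => s % p = r), (Y s ω - M s ω)) ∂μ :=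
          integral_mono (hint _ _) (integrable_finsetSum _ fun r _ =>
            (hint _ _).const_mul _) hjensen
      _ = ∑ r ∈ Finset.range p, 1 / (p : ℝ) * ∫ ω, Real.exp (p * θ *
          ∑ s ∈ (Finset.range N).filter (fun s => s % p = r), (Y s ω - M s ω)) ∂μ := by
          rw [integral_finsetSum _ fun r _ => (hint _ _).const_mul _]
          simp_rw [integral_const_mul]
      _ ≤ ∑ r ∈ Finset.range p, 1 / (p : ℝ) *
          Real.exp (θ ^ 2 * (c ^ 2 * p * (N + p - 1 : ℕ)) / 2) := by
          refine Finset.sum_le_sum fun r _ => mul_le_mul_of_nonneg_left ?_ (by positivity)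
          refine (integral_exp_block_le hmono hle hc hY hM hYc hMc hcond r (p * θ) N).trans
            (Real.exp_le_exp.2 ?_)
          have h : (p : ℝ) * ((Finset.range N).filter fun s => s % p = r).card
              ≤ ((N + p - 1 : ℕ) : ℝ) := by exact_mod_cast card_filter_mod_eq_le hp r N
          calc (p * θ) ^ 2 * c ^ 2 / 2 * ((Finset.range N).filter fun s => s % p = r).card
              = θ ^ 2 * c ^ 2 * p / 2 * (p * ((Finset.range N).filter fun s => s % p = r).card) := by
                ring
            _ ≤ θ ^ 2 * c ^ 2 * p / 2 * ((N + p - 1 : ℕ) : ℝ) := by gcongr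
            _ = _ := by ring
      _ = _ := by
          rw [Finset.sum_const, Finset.card_range, nsmul_eq_mul]; field_simp
  set v : ℝ := c ^ 2 * p * (N + p - 1 : ℕ) with hv
  have hv0 : 0 < v := by positivity
  -- Chernoff's bound at the optimal parameter `γ / v`.
  refine (measure_ge_le_exp_mul_mgf γ (t := γ / v) (by positivity) (hint _ _)).trans ?_
  calc Real.exp (-(γ / v) * γ) * mgf (fun ω => ∑ s ∈ Finset.range N, (Y s ω - M s ω)) μ (γ / v)
      ≤ Real.exp (-(γ / v) * γ) * Real.exp ((γ / v) ^ 2 * v / 2) := by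
        gcongr; exact hmgf _
    _ = _ := by rw [← Real.exp_add]; congr 1; field_simp; ring

end Concentration

/-! ### Conditional laws of the token and of the samples. -/

section Sampling

variable {Ω Ξ : Type*} {m m0 : MeasurableSpace Ω} [MeasurableSpace Ξ] {μ : Measure Ω}

/-- Integration of a variable whose conditional law is given by a kernel. -/
theorem integral_eq_integral_kernel [IsProbabilityMeasure μ] {S : Type*} [MeasurableSpace S]
    (hm : m ≤ m0) {Y : Ω → S}
    (hY : Measurable[m] Y) (κ : Kernel S Ξ) [IsMarkovKernel κ] {Z : Ω → Ξ} (hZ : Measurable Z)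
    (hlaw : ∀ A, MeasurableSet A →
      μ[(Z ⁻¹' A).indicator (fun _ => (1 : ℝ)) | m] =ᵐ[μ] fun ω => (κ (Y ω)).real A)
    {Φ : S × Ξ → ℝ} (hΦ : Measurable Φ) {B : ℝ} (hB : ∀ q, |Φ q| ≤ B) :
    ∫ ω, Φ (Y ω, Z ω) ∂μ = ∫ ω, ∫ z, Φ (Y ω, z) ∂(κ (Y ω)) ∂μ := by
  have hY' : Measurable Y := hY.mono hm le_rfl
  have : IsProbabilityMeasure (μ.map Y) := Measure.isProbabilityMeasure_map hY'.aemeasurable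
  have hYZ : Measurable fun ω => (Y ω, Z ω) := hY'.prodMk hZ
  have : IsProbabilityMeasure (μ.map fun ω => (Y ω, Z ω)) :=
    Measure.isProbabilityMeasure_map hYZ.aemeasurable
  -- The joint law is determined by rectangles, where the hypothesis on conditional expectations
  -- applies.
  have hmap : μ.map (fun ω => (Y ω, Z ω)) = (μ.map Y) ⊗ₘ κ := by
    refine Measure.ext_prod fun {s t} hs ht => ?_
    rw [Measure.map_apply hYZ (hs.prod ht), Measure.compProd_apply_prod hs ht,
      setLIntegral_map hs (κ.measurable_coe ht) hY']
    have hpre : (fun ω => (Y ω, Z ω)) ⁻¹' s ×ˢ t = Y ⁻¹' s ∩ Z ⁻¹' t := rfl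
    have hYs : MeasurableSet[m] (Y ⁻¹' s) := hY hs
    have h1 : ∫ ω in Y ⁻¹' s, (κ (Y ω)).real t ∂μ = μ.real (Y ⁻¹' s ∩ Z ⁻¹' t) := by
      rw [← setIntegral_congr_ae (hm _ hYs) ((hlaw t ht).mono fun ω h _ => h),
        setIntegral_condExp hm ((integrable_const 1).indicator (hZ ht)) hYs,
        integral_indicator_const _ (hZ ht), smul_eq_mul, mul_one,
        measureReal_restrict_apply (hZ ht), Set.inter_comm]
    have h2 : ∫⁻ ω in Y ⁻¹' s, κ (Y ω) t ∂μ
        = ENNReal.ofReal (∫ ω in Y ⁻¹' s, (κ (Y ω)).real t ∂μ) := by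
      rw [ofReal_integral_eq_lintegral_ofReal]
      · simp
      · exact (integrable_of_abs_le (B := 1) (((κ.measurable_coe ht).comp hY').ennreal_toReal)
          fun ω => (abs_of_nonneg measureReal_nonneg).trans_le measureReal_le_one).integrableOn
      · exact Filter.Eventually.of_forall fun ω => measureReal_nonneg
    rw [hpre, h2, h1, ofReal_measureReal]
  have hint : Integrable Φ ((μ.map Y) ⊗ₘ κ) := integrable_of_abs_le hΦ hB
  calc ∫ ω, Φ (Y ω, Z ω) ∂μ = ∫ q, Φ q ∂(μ.map fun ω => (Y ω, Z ω)) :=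
        (integral_map hYZ.aemeasurable hΦ.aestronglyMeasurable).symm
    _ = ∫ y, ∫ z, Φ (y, z) ∂(κ y) ∂(μ.map Y) := by
        rw [hmap, Measure.integral_compProd hint]
    _ = _ := integral_map hY'.aemeasurable
        (hΦ.stronglyMeasurable.integral_kernel_prod_right').aestronglyMeasurable

variable {n : ℕ} {loc : Fin n → Measure Ξ} {P : ℕ → Ω → Matrix (Fin n) (Fin n) ℝ}
  {token : ℕ → Ω → Fin n} {ξ : ℕ → Ω → Ξ}

theorem history_mono : Monotone (history P token ξ) := by
  intro s t hst
  refine sup_le_sup ?_ ?_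
  · exact biSup_mono fun r hr => Finset.mem_Icc.2 ⟨(Finset.mem_Icc.1 hr).1,
      (Finset.mem_Icc.1 hr).2.trans hst⟩
  · exact biSup_mono fun r hr => Finset.mem_Icc.2 ⟨(Finset.mem_Icc.1 hr).1,
      (Finset.mem_Icc.1 hr).2.trans hst⟩

theorem measurable_token_history {s t : ℕ} (hst : s ≤ t) :
    Measurable[history P token ξ t] (token s) := by
  rw [measurable_iff_comap_le]
  refine le_trans ?_ (le_sup_left : _ ≤ history P token ξ t)
  exact le_biSup (fun s => MeasurableSpace.comap (token s) ⊤)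
    (Finset.mem_Icc.2 ⟨Nat.zero_le s, hst⟩)

theorem measurable_sample_history {s t : ℕ} (hs : 1 ≤ s) (hst : s ≤ t) :
    Measurable[history P token ξ t] (ξ s) := by
  rw [measurable_iff_comap_le]
  refine le_trans ?_ (le_sup_right : _ ≤ history P token ξ t)
  refine le_trans ?_ (le_biSup
    (fun s => matrixSigma (P s) ⊔ MeasurableSpace.comap (ξ s) inferInstance)
    (Finset.mem_Icc.2 ⟨hs, hst⟩))
  exact le_sup_right

theorem measurable_matrixSigma (Q : Ω → Matrix (Fin n) (Fin n) ℝ) (i j : Fin n) :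
    Measurable[matrixSigma Q] fun ω => Q ω i j := by
  rw [measurable_iff_comap_le]
  exact le_iSup₂_of_le i j le_rfl

namespace IsRandomMIGDSampling

theorem matrixSigma_le (h : IsRandomMIGDSampling μ loc P token ξ) {t : ℕ} (ht : 1 ≤ t) :
    matrixSigma (P t) ≤ m0 :=
  iSup₂_le fun i j => (h.measurable_matrix t ht i j).comap_le

theorem token_comap_le (h : IsRandomMIGDSampling μ loc P token ξ) (t : ℕ) :
    MeasurableSpace.comap (token t) ⊤ ≤ m0 :=
  (h.measurable_token t).comap_le

theorem history_le (h : IsRandomMIGDSampling μ loc P token ξ) (t : ℕ) : history P token ξ t ≤ m0 := by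
  refine sup_le (iSup₂_le fun s _ => h.token_comap_le s) (iSup₂_le fun s hs => ?_)
  have hs1 := (Finset.mem_Icc.1 hs).1
  exact sup_le (h.matrixSigma_le hs1) (h.measurable_sample s hs1).comap_le

theorem integral_entry (h : IsRandomMIGDSampling μ loc P token ξ) (t : ℕ) (i j : Fin n) :
    ∫ ω, P (t + 1) ω i j ∂μ = meanMatrix μ (P 1) i j := by
  have h1 := (h.identDistrib (t + 1) (by omega)).comp
    (u := fun q : Fin n → Fin n → ℝ => q i j) (by fun_prop)
  exact h1.integral_eq

theorem integrable_entry [IsProbabilityMeasure μ]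
    (h : IsRandomMIGDSampling μ loc P token ξ) (t : ℕ) (i j : Fin n) :
    Integrable (fun ω => P (t + 1) ω i j) μ :=
  RandomMIGD.integrable_entry (h.measurable_matrix _ (by omega))
    (h.doublyStochastic _ (by omega)) i j

/-- One step of the token, averaged over the random matrix. -/
theorem integral_token_succ [IsProbabilityMeasure μ]
    (h : IsRandomMIGDSampling μ loc P token ξ) (t : ℕ) {U : Fin n → Ω → ℝ}
    (hU : ∀ j, Measurable[history P token ξ t] (U j)) {B : ℝ} (hB : ∀ j ω, |U j ω| ≤ B) :
    ∫ ω, U (token (t + 1) ω) ω ∂μ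
      = ∫ ω, (meanMatrix μ (P 1) *ᵥ fun j => U j ω) (token t ω) ∂μ := by
  have hle := h.history_le t
  have hσ : history P token ξ t ⊔ matrixSigma (P (t + 1)) ≤ m0 :=
    sup_le hle (h.matrixSigma_le (by omega))
  have hU' : ∀ j, Measurable (U j) := fun j => (hU j).mono hle le_rfl
  have hUint : ∀ j, Integrable (U j) μ := fun j => integrable_of_abs_le (hU' j) (hB j)
  have htok : ∀ s j, MeasurableSet (token s ⁻¹' {j}) := fun s j =>
    h.measurable_token s (MeasurableSet.singleton j)
  have hind : ∀ s j, Integrable (fun ω => (token s ⁻¹' {j}).indicator (fun _ => (1 : ℝ)) ω * U j ω)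
      μ := fun s j => by
    have := (hUint j).indicator (htok s j)
    refine this.congr (Filter.Eventually.of_forall fun ω => ?_)
    by_cases hω : ω ∈ token s ⁻¹' {j} <;> simp [hω]
  -- `U j` is known given the history, so it comes out of the conditional expectation and
  -- `token_law` applies.
  have hpull : ∀ j, ∫ ω, (token (t + 1) ⁻¹' {j}).indicator (fun _ => (1 : ℝ)) ω * U j ω ∂μ
      = ∫ ω, P (t + 1) ω (token t ω) j * U j ω ∂μ := fun j => by
    rw [← integral_condExp hσ]
    refine integral_congr_ae ?_
    have h1 := condExp_mul_of_stronglyMeasurable_right (μ := μ)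
      (f := (token (t + 1) ⁻¹' {j}).indicator (fun _ => (1 : ℝ)))
      ((hU j).mono le_sup_left le_rfl :
        Measurable[history P token ξ t ⊔ matrixSigma (P (t + 1))] (U j)).stronglyMeasurable
      (hind (t + 1) j) ((integrable_const 1).indicator (htok (t + 1) j))
    refine h1.trans ?_
    filter_upwards [h.token_law t j] with ω hω
    rw [Pi.mul_apply, hω]
  -- The new matrix is independent of the history, hence of both the current token and `U j`; its
  -- entry may be replaced by the mean.
  have hprod : ∀ i j, ∫ ω, P (t + 1) ω i j *
      ((token t ⁻¹' {i}).indicator (fun _ => (1 : ℝ)) ω * U j ω) ∂μ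
      = meanMatrix μ (P 1) i j *
        ∫ ω, (token t ⁻¹' {i}).indicator (fun _ => (1 : ℝ)) ω * U j ω ∂μ := fun i j => by
    have hm1 : Measurable[history P token ξ t]
        fun ω => (token t ⁻¹' {i}).indicator (fun _ => (1 : ℝ)) ω * U j ω := by
      refine Measurable.mul ?_ (hU j)
      exact measurable_const.indicator
        (measurable_token_history le_rfl (MeasurableSet.singleton i))
    have hI : IndepFun (fun ω => P (t + 1) ω i j)
        (fun ω => (token t ⁻¹' {i}).indicator (fun _ => (1 : ℝ)) ω * U j ω) μ := by
      rw [IndepFun_iff_Indep]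
      exact indep_of_indep_of_le_left (indep_of_indep_of_le_right (h.indep t) hm1.comap_le)
        (measurable_matrixSigma _ i j).comap_le
    rw [← h.integral_entry t i j]
    exact hI.integral_fun_mul_eq_mul_integral (h.integrable_entry t i j).aestronglyMeasurable
      (hm1.mono hle le_rfl).aestronglyMeasurable
  have hind2 : ∀ i j, Integrable
      (fun ω => (token t ⁻¹' {i}).indicator (fun _ => (1 : ℝ)) ω * U j ω) μ := fun i j => by
    have := (hUint j).indicator (htok t i)
    refine this.congr (Filter.Eventually.of_forall fun ω => ?_)
    by_cases hω : ω ∈ token t ⁻¹' {i} <;> simp [hω]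
  have hPint : ∀ i j, Integrable (fun ω => P (t + 1) ω i j *
      ((token t ⁻¹' {i}).indicator (fun _ => (1 : ℝ)) ω * U j ω)) μ := fun i j => by
    refine (hind2 i j).bdd_mul (c := 1)
      (h.measurable_matrix _ (by omega) i j).aestronglyMeasurable ?_
    filter_upwards [h.doublyStochastic (t + 1) (by omega)] with ω hω
    rw [Real.norm_eq_abs, abs_of_nonneg (nonneg_of_mem_doublyStochastic hω)]
    exact le_one_of_mem_doublyStochastic hω
  have hdecomp : ∀ ω i, (token t ⁻¹' {i}).indicator (fun _ => (1 : ℝ)) ω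
      = if token t ω = i then 1 else 0 := fun ω i => by
    simp [Set.indicator]
  have hR : ∀ ω, (meanMatrix μ (P 1) *ᵥ fun j => U j ω) (token t ω) =
      ∑ j, ∑ i, meanMatrix μ (P 1) i j *
        ((token t ⁻¹' {i}).indicator (fun _ => (1 : ℝ)) ω * U j ω) := fun ω => by
    simp only [hdecomp, Matrix.mulVec, dotProduct]
    refine Finset.sum_congr rfl fun j _ => ?_
    rw [Finset.sum_eq_single (token t ω)] <;> simp +contextual [eq_comm]
  have hL : ∀ ω, U (token (t + 1) ω) ω
      = ∑ j, (token (t + 1) ⁻¹' {j}).indicator (fun _ => (1 : ℝ)) ω * U j ω := fun ω => by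
    rw [Finset.sum_eq_single (token (t + 1) ω)] <;> simp +contextual [Set.indicator, eq_comm]
  have hPd : ∀ ω j, P (t + 1) ω (token t ω) j * U j ω = ∑ i, P (t + 1) ω i j *
      ((token t ⁻¹' {i}).indicator (fun _ => (1 : ℝ)) ω * U j ω) := fun ω j => by
    simp only [hdecomp]
    rw [Finset.sum_eq_single (token t ω)] <;> simp +contextual [eq_comm]
  simp_rw [hL, hR]
  rw [integral_finsetSum _ fun j _ => hind (t + 1) j, integral_finsetSum _ fun j _ =>
    integrable_finsetSum _ fun i _ => (hind2 i j).const_mul _]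
  refine Finset.sum_congr rfl fun j _ => ?_
  rw [hpull j]
  simp_rw [hPd]
  rw [integral_finsetSum _ fun i _ => hPint i j, integral_finsetSum _ fun i _ =>
    (hind2 i j).const_mul _]
  refine Finset.sum_congr rfl fun i _ => ?_
  rw [hprod i j, integral_const_mul]

/-- The Markov property of the token over `k` steps, averaged over the random matrices. -/
theorem integral_token_add [IsProbabilityMeasure μ]
    (h : IsRandomMIGDSampling μ loc P token ξ) (t k : ℕ) {U : Fin n → Ω → ℝ}
    (hU : ∀ j, Measurable[history P token ξ t] (U j)) {B : ℝ} (hB : ∀ j ω, |U j ω| ≤ B) :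
    ∫ ω, U (token (t + k) ω) ω ∂μ
      = ∫ ω, (meanMatrix μ (P 1) ^ k *ᵥ fun j => U j ω) (token t ω) ∂μ := by
  induction k generalizing U B with
  | zero => simp
  | succ k ih =>
    rw [← add_assoc, h.integral_token_succ (t + k)
      (fun j => (hU j).mono (history_mono (Nat.le_add_right t k)) le_rfl) hB,
      -- The last of the `k + 1` moves is averaged out first, which replaces `U` by the mean matrix
      -- applied to `U`; the induction hypothesis handles the other `k`. The bound only has to be
      -- finite.
      ih (U := fun i ω => (meanMatrix μ (P 1) *ᵥ fun j => U j ω) i)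
      (B := ∑ i, ∑ j, |meanMatrix μ (P 1) i j| * B)]
    · simp_rw [Matrix.mulVec_mulVec, ← pow_succ]
    · intro i
      simp only [Matrix.mulVec, dotProduct]
      exact Finset.measurable_sum _ fun j _ => (hU j).const_mul _
    · intro i ω
      simp only [Matrix.mulVec, dotProduct]
      calc |∑ j, meanMatrix μ (P 1) i j * U j ω| ≤ ∑ j, |meanMatrix μ (P 1) i j * U j ω| :=
            Finset.abs_sum_le_sum_abs _ _
        _ ≤ ∑ j, |meanMatrix μ (P 1) i j| * B := Finset.sum_le_sum fun j _ => by
            rw [abs_mul]; exact mul_le_mul_of_nonneg_left (hB j ω) (abs_nonneg _)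
        _ ≤ _ := Finset.single_le_sum (f := fun i => ∑ j, |meanMatrix μ (P 1) i j| * B)
            (fun i _ => Finset.sum_nonneg fun j _ => mul_nonneg (abs_nonneg _)
              ((abs_nonneg _).trans (hB j ω))) (Finset.mem_univ i)

/-- The conditional mean, given the history up to time `t`, of a function of the sample drawn
`p ≥ 1` steps later. -/
theorem integral_mul_sample [IsProbabilityMeasure μ]
    (h : IsRandomMIGDSampling μ loc P token ξ) (hloc : ∀ i, IsProbabilityMeasure (loc i)) {S : Type*}
    [MeasurableSpace S] (t : ℕ) {p : ℕ} (hp : 1 ≤ p) {x : Ω → S}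
    (hx : Measurable[history P token ξ t] x) {H : S → Ξ → ℝ}
    (hH : Measurable fun q : S × Ξ => H q.1 q.2)
    {c : ℝ} (hc : ∀ s z, |H s z| ≤ c) {V : Ω → ℝ} (hV : Measurable[history P token ξ t] V) {B : ℝ}
    (hB : ∀ ω, |V ω| ≤ B) :
    ∫ ω, V ω * H (x ω) (ξ (t + p) ω) ∂μ
      = ∫ ω, V ω * (meanMatrix μ (P 1) ^ p *ᵥ fun j => ∫ z, H (x ω) z ∂(loc j)) (token t ω) ∂μ := by
  obtain ⟨k, rfl⟩ : ∃ k, p = k + 1 := ⟨p - 1, by omega⟩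
  have hle := h.history_le
  have hmm := history_mono (P := P) (token := token) (ξ := ξ) (Nat.le_add_right t k)
  have h𝒢le : history P token ξ (t + k) ⊔ matrixSigma (P (t + k + 1)) ⊔
      MeasurableSpace.comap (token (t + k + 1)) ⊤ ≤ m0 :=
    sup_le (sup_le (hle _) (h.matrixSigma_le (by omega))) (h.token_comap_le _)
  have hh𝒢 : history P token ξ t ≤ history P token ξ (t + k) ⊔ matrixSigma (P (t + k + 1)) ⊔
      MeasurableSpace.comap (token (t + k + 1)) ⊤ := hmm.trans (le_sup_left.trans le_sup_left)
  have hY : Measurable[history P token ξ (t + k) ⊔ matrixSigma (P (t + k + 1)) ⊔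
      MeasurableSpace.comap (token (t + k + 1)) ⊤] fun ω => (x ω, V ω, token (t + k + 1) ω) := by
    refine (hx.mono hh𝒢 le_rfl).prodMk ((hV.mono hh𝒢 le_rfl).prodMk ?_)
    rw [measurable_iff_comap_le]
    exact le_sup_right
  let κ : Kernel (S × ℝ × Fin n) Ξ :=
    (Kernel.ofFunOfCountable loc).comap (fun q => q.2.2) (by fun_prop)
  have hκ : ∀ q, κ q = loc q.2.2 := fun q => rfl
  have : IsMarkovKernel κ := ⟨fun q => by rw [hκ]; exact hloc _⟩
  have hBpos : 0 ≤ B := by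
    obtain ⟨ω⟩ : Nonempty Ω := nonempty_of_isProbabilityMeasure μ
    exact (abs_nonneg _).trans (hB ω)
  -- The kernel formula asks for a test function bounded on the whole product, so the coordinate
  -- holding `V` is truncated to `[-B, B]`, where `V` already lives.
  let cut : ℝ → ℝ := fun r => max (-B) (min r B)
  have hcut : ∀ ω, cut (V ω) = V ω := fun ω => by
    obtain ⟨h1, h2⟩ := abs_le.1 (hB ω)
    simp [cut, min_eq_left h2, max_eq_right h1]
  have hcutB : ∀ r, |cut r| ≤ B := fun r =>
    abs_le.2 ⟨le_max_left _ _, max_le (by linarith) (min_le_right _ _)⟩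
  have hΦ : Measurable fun q : (S × ℝ × Fin n) × Ξ => cut q.1.2.1 * H q.1.1 q.2 := by
    refine Measurable.mul ?_ (hH.comp (by fun_prop : Measurable
      fun q : (S × ℝ × Fin n) × Ξ => (q.1.1, q.2)))
    exact measurable_const.max ((by fun_prop : Measurable
      fun q : (S × ℝ × Fin n) × Ξ => q.1.2.1).min measurable_const)
  have h1 := integral_eq_integral_kernel h𝒢le hY κ (h.measurable_sample (t + k + 1) (by omega))
    (fun A hA => h.sample_law (t + k) A hA) hΦ (B := B * c) fun q => by
      rw [abs_mul]
      exact mul_le_mul (hcutB _) (hc _ _) (abs_nonneg _) hBpos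
  simp only [hcut, hκ, integral_const_mul] at h1
  rw [← add_assoc, h1]
  have hVm : ∀ j, Measurable fun s : S => ∫ z, H s z ∂(loc j) := fun j =>
    (hH.stronglyMeasurable.integral_prod_right (ν := loc j)).measurable
  have hVc : ∀ s j, |∫ z, H s z ∂(loc j)| ≤ c := fun s j => by
    have := norm_integral_le_of_norm_le_const (μ := loc j) (f := fun z => H s z) (C := c)
      (Filter.Eventually.of_forall fun z => hc s z)
    simpa using this
  have h2 := h.integral_token_add t (k + 1) (U := fun j ω => V ω * ∫ z, H (x ω) z ∂(loc j))
    (fun j => hV.mul ((hVm j).comp hx)) (B := B * c) fun j ω => by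
      rw [abs_mul]
      exact mul_le_mul (hB ω) (hVc _ _) (abs_nonneg _) hBpos
  rw [← add_assoc] at h2
  rw [h2]
  congr 1
  ext ω
  rw [← smul_eq_mul (V ω), ← Pi.smul_apply, ← Matrix.mulVec_smul]
  rfl

/-- Almost surely the samples avoid a set that is null for every local distribution. -/
theorem ae_sample_mem [IsProbabilityMeasure μ]
    (h : IsRandomMIGDSampling μ loc P token ξ) {A : Set Ξ} (hA : MeasurableSet A)
    (h0 : ∀ i, loc i Aᶜ = 0) :
    ∀ᵐ ω ∂μ, ∀ t, 1 ≤ t → ξ t ω ∈ A := by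
  rw [ae_all_iff]
  intro t
  rcases Nat.eq_zero_or_pos t with rfl | ht
  · simp
  obtain ⟨s, rfl⟩ : ∃ s, t = s + 1 := ⟨t - 1, by omega⟩
  have h𝒢le : history P token ξ s ⊔ matrixSigma (P (s + 1)) ⊔
      MeasurableSpace.comap (token (s + 1)) ⊤ ≤ m0 :=
    sup_le (sup_le (h.history_le _) (h.matrixSigma_le (by omega))) (h.token_comap_le _)
  have hpre : MeasurableSet (ξ (s + 1) ⁻¹' Aᶜ) := h.measurable_sample _ (by omega) hA.compl
  have h1 : ∫ ω, (ξ (s + 1) ⁻¹' Aᶜ).indicator (fun _ => (1 : ℝ)) ω ∂μ = 0 := by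
    rw [← integral_condExp h𝒢le, integral_congr_ae (h.sample_law s Aᶜ hA.compl)]
    simp [Measure.real, h0]
  rw [integral_indicator_const _ hpre, smul_eq_mul, mul_one, measureReal_eq_zero_iff] at h1
  have h2 : ∀ᵐ ω ∂μ, ω ∉ ξ (s + 1) ⁻¹' Aᶜ := measure_eq_zero_iff_ae_notMem.1 h1
  filter_upwards [h2] with ω hω _
  simpa using hω

end IsRandomMIGDSampling

end Sampling

/-! ### Measurability of the mirror descent update. -/

section Measurability

variable {Ω E : Type*} [MeasurableSpace Ω] [NormedAddCommGroup E] [MeasurableSpace E]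
  [BorelSpace E] {X : Set E} {ψ : E → ℝ}

theorem measurable_comp_of_continuousOn {f : E → ℝ} (hf : ContinuousOn f X) {x : Ω → E}
    (hx : Measurable x) (hxX : ∀ ω, x ω ∈ X) : Measurable fun ω => f (x ω) :=
  (continuousOn_iff_continuous_domRestrict.1 hf).measurable.comp
    (hx.subtype_mk : Measurable fun ω => (⟨x ω, hxX ω⟩ : X))

variable [NormedSpace ℝ E] [FiniteDimensional ℝ E]

/-- The derivative of `ψ` is not assumed continuous in its base point. Along the segment to `y` it
is a pointwise limit of difference quotients, which are continuous on `X`. -/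
theorem measurable_bregman (hψ : DifferentiableOn ℝ ψ X) (hX : Convex ℝ X) {x : Ω → E}
    (hx : Measurable x) (hxX : ∀ ω, x ω ∈ X) {y : E} (hy : y ∈ X) :
    Measurable fun ω => bregman ψ X y (x ω) := by
  have : ProperSpace E := FiniteDimensional.proper_real E
  have hψx := measurable_comp_of_continuousOn hψ.continuousOn hx hxX
  refine (measurable_const.sub hψx).sub ?_
  refine measurable_of_tendsto_metrizable
    (f := fun (k : ℕ) ω => ((k : ℝ) + 1) *
      (ψ (x ω + (1 / ((k : ℝ) + 1)) • (y - x ω)) - ψ (x ω))) (fun k => ?_)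
    (tendsto_pi_nhds.2 fun ω => tendsto_segment_slope hX hψ (hxX ω) hy)
  refine ((measurable_comp_of_continuousOn hψ.continuousOn (by fun_prop) fun ω => ?_).sub
    hψx).const_mul _
  have h0 : (0 : ℝ) < (k : ℝ) + 1 := by positivity
  refine hX.add_smul_sub_mem (hxX ω) hy ⟨by positivity, ?_⟩
  rw [div_le_one h0]; linarith [(Nat.cast_nonneg k : (0 : ℝ) ≤ k)]

/-- The mirror descent update depends measurably on the current point and the subgradient. -/
theorem measurable_mirrorStep (hψ : DifferentiableOn ℝ ψ X) (hψc : StrongConvexOn X 1 ψ)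
    {a : ℝ} (ha : 0 < a) {g : Ω → E →L[ℝ] ℝ} {x x' : Ω → E} (hg : Measurable g)
    (hx : Measurable x) (hxX : ∀ ω, x ω ∈ X)
    (hstep : ∀ ω, IsMirrorStep ψ X a (g ω) (x ω) (x' ω)) : Measurable x' := by
  have : ProperSpace E := FiniteDimensional.proper_real E
  let obj : E → Ω → ℝ := fun y ω => g ω y + (1 / a) * bregman ψ X y (x ω)
  have hobj : ∀ y ∈ X, Measurable (obj y) := fun y hy =>
    ((ContinuousLinearMap.apply ℝ ℝ y).continuous.measurable.comp hg).add
      ((measurable_bregman hψ hψc.1 hx hxX hy).const_mul _)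
  have hcont : ∀ ω, ContinuousOn (fun y => obj y ω) X := fun ω => by
    refine (g ω).continuous.continuousOn.add (ContinuousOn.const_mul ?_ _)
    refine (hψ.continuousOn.sub continuousOn_const).sub ?_
    exact ((fderivWithin ℝ ψ X (x ω)).continuous.comp (continuous_sub_right (x ω))).continuousOn
  refine measurable_of_isClosed fun K hK => ?_
  rcases (K ∩ X).eq_empty_or_nonempty with hem | hne
  · have : x' ⁻¹' K = ∅ := Set.eq_empty_of_forall_notMem fun ω hω =>
      (Set.eq_empty_iff_forall_notMem.1 hem) (x' ω) ⟨hω, (hstep ω).1⟩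
    rw [this]; exact MeasurableSet.empty
  have : Nonempty (K ∩ X : Set E) := hne.to_subtype
  have : Nonempty X := ⟨⟨_, hne.some_mem.2⟩⟩
  let d : ℕ → (K ∩ X : Set E) := TopologicalSpace.denseSeq _
  let e : ℕ → X := TopologicalSpace.denseSeq _
  -- The minimizer lies in `K` iff, for every tolerance, some point of a countable dense subset of
  -- `K ∩ X` is nearly optimal against a countable dense subset of `X`. This leaves only countable
  -- operations on measurable conditions.
  have hset : x' ⁻¹' K = ⋂ j : ℕ, ⋃ k : ℕ, ⋂ l : ℕ,
      {ω | obj (d k) ω ≤ obj (e l) ω + 1 / ((j : ℝ) + 1)} := by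
    ext ω
    simp only [Set.mem_preimage, Set.mem_iInter, Set.mem_iUnion, Set.mem_ofPred_eq]
    constructor
    · intro hω j
      have hj : (0 : ℝ) < 1 / ((j : ℝ) + 1) := by positivity
      have hopen : IsOpen {y : (K ∩ X : Set E) | obj y ω < obj (x' ω) ω + 1 / ((j : ℝ) + 1)} :=
        isOpen_lt (((hcont ω).mono Set.inter_subset_right).domRestrict) continuous_const
      obtain ⟨k, hk⟩ := (TopologicalSpace.denseRange_denseSeq (K ∩ X : Set E)).exists_mem_open
        hopen ⟨⟨x' ω, hω, (hstep ω).1⟩, by simpa using hj⟩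
      refine ⟨k, fun l => ?_⟩
      have h1 : obj (x' ω) ω ≤ obj (e l) ω := (hstep ω).2 (e l).2
      have h2 : obj (d k) ω < obj (x' ω) ω + 1 / ((j : ℝ) + 1) := hk
      linarith
    · intro hω
      choose k hk using hω
      have hle : ∀ j, obj (d (k j)) ω ≤ obj (x' ω) ω + 1 / ((j : ℝ) + 1) := fun j => by
        have hclosed : IsClosed {y : X | obj (d (k j)) ω ≤ obj y ω + 1 / ((j : ℝ) + 1)} :=
          isClosed_le continuous_const ((hcont ω).domRestrict.add continuous_const)
        have hall := hclosed.closure_subset_iff.2 (Set.range_subset_iff.2 (hk j))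
        rw [(TopologicalSpace.denseRange_denseSeq X).closure_range] at hall
        exact hall (Set.mem_univ ⟨x' ω, (hstep ω).1⟩)
      -- Quadratic growth forces near-minimizers to converge to the minimizer, which therefore lies
      -- in the closed set `K`.
      have hdist : ∀ j, ‖(d (k j) : E) - x' ω‖ ^ 2 ≤ 2 * a * (1 / ((j : ℝ) + 1)) := fun j => by
        have h1 := (hstep ω).growth hψ hψc ha (d (k j)).2.2
        have h2 : 1 / (2 * a) * ‖(d (k j) : E) - x' ω‖ ^ 2 ≤ 1 / ((j : ℝ) + 1) := by
          have := hle j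
          simp only [obj] at this
          linarith
        have h3 := mul_le_mul_of_nonneg_left h2 (by positivity : 0 ≤ 2 * a)
        rwa [← mul_assoc, mul_one_div_cancel (by positivity), one_mul] at h3
      have hlim : Filter.Tendsto (fun j => (d (k j) : E)) Filter.atTop (nhds (x' ω)) := by
        rw [tendsto_iff_norm_sub_tendsto_zero]
        have h0 : Filter.Tendsto (fun j : ℕ => √(2 * a * (1 / ((j : ℝ) + 1)))) Filter.atTop
            (nhds 0) := by
          have := ((tendsto_one_div_add_atTop_nhds_zero_nat (𝕜 := ℝ)).const_mul (2 * a)).sqrt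
          simpa using this
        exact squeeze_zero (fun _ => norm_nonneg _) (fun j => Real.le_sqrt_of_sq_le (hdist j)) h0
      exact hK.mem_of_tendsto hlim (Filter.Eventually.of_forall fun j => (d (k j)).2.1)
  rw [hset]
  refine MeasurableSet.iInter fun j => MeasurableSet.iUnion fun k => MeasurableSet.iInter fun l => ?_
  exact measurableSet_le (hobj _ (d k).2.2) ((hobj _ (e l).2).add_const _)

end Measurability

/-! ### Exceptional null sets and events indexed by a continuum. -/

section Preliminaries

/-- The exceptional set need not be measurable; its measurable hull for the sum of the measures is
null for all of them at once. -/
theorem exists_measurableSet_of_ae {ι Ξ : Type*} [Countable ι] [MeasurableSpace Ξ]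
    {loc : ι → Measure Ξ} {q : Ξ → Prop} (h : ∀ i, ∀ᵐ z ∂(loc i), q z) :
    ∃ A, MeasurableSet A ∧ (∀ i, loc i Aᶜ = 0) ∧ ∀ z ∈ A, q z := by
  have h0 : Measure.sum loc {z | ¬ q z} = 0 := by
    have : ∀ᵐ z ∂(Measure.sum loc), q z := Measure.ae_sum_iff.2 h
    exact this
  refine ⟨(toMeasurable (Measure.sum loc) {z | ¬ q z})ᶜ, (measurableSet_toMeasurable _ _).compl,
    fun i => ?_, fun z hz => ?_⟩
  · rw [compl_compl]
    refine le_antisymm ?_ zero_le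
    calc loc i (toMeasurable (Measure.sum loc) {z | ¬ q z})
        ≤ Measure.sum loc (toMeasurable (Measure.sum loc) {z | ¬ q z}) := Measure.le_sum loc i _
      _ = 0 := by rw [measure_toMeasurable, h0]
  · by_contra hq
    exact hz (subset_toMeasurable _ _ hq)

theorem abs_mulVec_le_of_mem_doublyStochastic {n : ℕ} {A : Matrix (Fin n) (Fin n) ℝ}
    (hA : A ∈ doublyStochastic ℝ (Fin n)) {v : Fin n → ℝ} {c : ℝ} (hv : ∀ j, |v j| ≤ c)
    (i : Fin n) : |(A *ᵥ v) i| ≤ c := by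
  simp only [Matrix.mulVec, dotProduct]
  calc |∑ j, A i j * v j| ≤ ∑ j, |A i j * v j| := Finset.abs_sum_le_sum_abs _ _
    _ ≤ ∑ j, A i j * c := Finset.sum_le_sum fun j _ => by
        rw [abs_mul, abs_of_nonneg (nonneg_of_mem_doublyStochastic hA)]
        exact mul_le_mul_of_nonneg_left (hv j) (nonneg_of_mem_doublyStochastic hA)
    _ = c := by rw [← Finset.sum_mul, sum_row_of_mem_doublyStochastic hA, one_mul]

/-- A uniform lower bound on `μ {Z ≤ r i}` passes to the event that `Z ≤ r i` for all `i`. -/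
theorem le_measureReal_forall_le {Ω ι : Type*} [MeasurableSpace Ω] {μ : Measure Ω}
    [IsProbabilityMeasure μ] [Nonempty ι] {Z : Ω → ℝ} (hZ : Measurable Z) {r : ι → ℝ}
    (hr : BddBelow (Set.range r)) {q : ℝ} (h : ∀ i, q ≤ μ.real {ω | Z ω ≤ r i}) :
    q ≤ μ.real {ω | ∀ i, Z ω ≤ r i} := by
  -- The same `Z` appears for every `i`, so the events are nested and their possibly uncountable
  -- intersection is `{Z ≤ ⨅ i, r i}`, a decreasing limit of the sets `A k`.
  let A : ℕ → Set Ω := fun k => {ω | Z ω ≤ (⨅ i, r i) + 1 / ((k : ℝ) + 1)}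
  have hA : ∀ k, MeasurableSet (A k) := fun k => measurableSet_le hZ measurable_const
  have hanti : Antitone A := fun k l hkl ω (hω : Z ω ≤ _) => by
    have : 1 / ((l : ℝ) + 1) ≤ 1 / ((k : ℝ) + 1) := by gcongr
    exact hω.trans (by linarith)
  have hq : ∀ k, q ≤ μ.real (A k) := fun k => by
    obtain ⟨i, hi⟩ := exists_lt_of_ciInf_lt
      (show (⨅ i, r i) < (⨅ i, r i) + 1 / ((k : ℝ) + 1) by
        have : (0 : ℝ) < 1 / ((k : ℝ) + 1) := by positivity
        linarith)
    exact (h i).trans (measureReal_mono fun ω (hω : Z ω ≤ r i) => hω.trans hi.le)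
  have hsub : ⋂ k, A k ⊆ {ω | ∀ i, Z ω ≤ r i} := fun ω hω i => by
    refine le_trans ?_ (ciInf_le hr i)
    have hlim := (tendsto_one_div_add_atTop_nhds_zero_nat (𝕜 := ℝ)).const_add (⨅ i, r i)
    rw [add_zero] at hlim
    exact ge_of_tendsto' hlim fun k => Set.mem_iInter.1 hω k
  have hlim := (ENNReal.tendsto_toReal (measure_ne_top μ (⋂ k, A k))).comp
    (tendsto_measure_iInter_atTop (μ := μ) (fun k => (hA k).nullMeasurableSet) hanti
      ⟨0, measure_ne_top μ _⟩)
  exact (ge_of_tendsto' hlim hq).trans (measureReal_mono hsub)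

end Preliminaries

/-! ### Regret against delayed iterates. -/

section Pathwise

variable {E : Type*} [NormedAddCommGroup E] [NormedSpace ℝ E] {X : Set E} {ψ : E → ℝ}

/-- Delayed regret along a path: the losses of the rounds `p, …, p + N - 1` at the iterates that
are `p - 1` rounds older. -/
theorem sum_delayed_loss_le (hψ : DifferentiableOn ℝ ψ X) (hψc : StrongConvexOn X 1 ψ)
    {R G a : ℝ} (hD : ∀ x ∈ X, ∀ y ∈ X, bregman ψ X x y ≤ 1 / 2 * R ^ 2) (ha : 0 < a)
    (hG : 0 ≤ G) {x : ℕ → E} {g : ℕ → E →L[ℝ] ℝ} (hx : ∀ t, 1 ≤ t → x t ∈ X)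
    (hg : ∀ t, 1 ≤ t → ‖g t‖ ≤ G)
    (hstep : ∀ t : ℕ, 1 ≤ t → IsMirrorStep ψ X (a / √(t : ℝ)) (g t) (x t) (x (t + 1)))
    {φ : ℕ → E → ℝ} (hφ : ∀ t, 1 ≤ t → ∀ y ∈ X, ∀ y' ∈ X, |φ t y - φ t y'| ≤ G * ‖y - y'‖)
    (hsub : ∀ t, 1 ≤ t → IsSubgradientOn (φ t) X (x t) (g t))
    {p : ℕ} (hp : 1 ≤ p) {y : E} (hy : y ∈ X) (N : ℕ) :
    ∑ s ∈ Finset.range N, (φ (s + p) (x (s + 1)) - φ (s + p) y)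
      ≤ (2 * (p - 1) + 1) * (a * G ^ 2 * √(N : ℝ))
        + √((N + p - 1 : ℕ) : ℝ) / a * (1 / 2 * R ^ 2) := by
  have h1 := sum_regret_le hψ hψc hD ha hx hg hstep hp hy N
  have hp1 : (1 : ℝ) ≤ p := by exact_mod_cast hp
  -- Moving from `x (s + 1)` to `x (s + p)` costs `G` times the drift over `p - 1` rounds; the
  -- subgradient inequality takes over from there. After summation the drift contributes `2 * (p -
  -- 1)` and the regret the extra `1`.
  have h2 : ∀ s, φ (s + p) (x (s + 1)) - φ (s + p) y
      ≤ ((p : ℝ) - 1) * (a * G ^ 2) * (1 / √((s : ℝ) + 1)) + g (s + p) (x (s + p) - y) := by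
    intro s
    have hsp : 1 ≤ s + p := by omega
    have h3 := hφ _ hsp _ (hx (s + 1) (by omega)) _ (hx _ hsp)
    have h4 := hsub _ hsp y hy
    have h5 := norm_iterate_sub_le hψ hψc ha hx hg hstep s (p - 1)
    rw [show s + 1 + (p - 1) = s + p by omega] at h5
    rw [Nat.cast_sub hp, Nat.cast_one] at h5
    have h6 : g (s + p) (y - x (s + p)) = - g (s + p) (x (s + p) - y) := by
      rw [← map_neg]; congr 1; abel
    have h7 := mul_le_mul_of_nonneg_left h5 hG
    have h8 := (abs_le.1 h3).2
    rw [h6] at h4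
    have h9 : G * (((p : ℝ) - 1) * (a * G * (1 / √((s : ℝ) + 1))))
      = ((p : ℝ) - 1) * (a * G ^ 2) * (1 / √((s : ℝ) + 1)) := by ring
    linarith
  have h3 := mul_le_mul_of_nonneg_left (sum_inv_sqrt_le N)
    (by have : 0 ≤ (p : ℝ) - 1 := by linarith
        positivity : 0 ≤ ((p : ℝ) - 1) * (a * G ^ 2))
  calc ∑ s ∈ Finset.range N, (φ (s + p) (x (s + 1)) - φ (s + p) y)
      ≤ ∑ s ∈ Finset.range N, (((p : ℝ) - 1) * (a * G ^ 2) * (1 / √((s : ℝ) + 1))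
          + g (s + p) (x (s + p) - y)) := Finset.sum_le_sum fun s _ => h2 s
    _ = ((p : ℝ) - 1) * (a * G ^ 2) * ∑ s ∈ Finset.range N, 1 / √((s : ℝ) + 1)
          + ∑ s ∈ Finset.range N, g (s + p) (x (s + p) - y) := by
        rw [Finset.sum_add_distrib, Finset.mul_sum]
    _ ≤ _ := by linarith

end Pathwise

/-! ### Regularity of the objective and Jensen's inequality for the averaged iterate. -/

section Objective

variable {E : Type*} [NormedAddCommGroup E] {X : Set E}
  {n : ℕ} {Ξ : Type*} [MeasurableSpace Ξ] {loc : Fin n → Measure Ξ} {F : E → Ξ → ℝ}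

theorem abs_objective_sub_le (hn : 0 < n) (hloc : ∀ i, IsProbabilityMeasure (loc i))
    (hint : ∀ x ∈ X, ∀ i, Integrable (F x) (loc i)) {G : ℝ}
    (hLip : ∀ i, ∀ᵐ z ∂(loc i), ∀ x ∈ X, ∀ y ∈ X, |F x z - F y z| ≤ G * ‖x - y‖) {x y : E}
    (hx : x ∈ X) (hy : y ∈ X) : |objective F loc x - objective F loc y| ≤ G * ‖x - y‖ := by
  have hn0 : (0 : ℝ) < n := by exact_mod_cast hn
  have h1 : objective F loc x - objective F loc y =
      1 / (n : ℝ) * ∑ i, ∫ z, (F x z - F y z) ∂(loc i) := by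
    unfold objective
    rw [← mul_sub, ← Finset.sum_sub_distrib]
    simp_rw [fun i => integral_sub (hint x hx i) (hint y hy i)]
  have h2 : ∀ i, |∫ z, (F x z - F y z) ∂(loc i)| ≤ G * ‖x - y‖ := fun i => by
    have := norm_integral_le_of_norm_le_const (μ := loc i) (f := fun z => F x z - F y z)
      (C := G * ‖x - y‖) ((hLip i).mono fun z hz => hz x hx y hy)
    simpa using this
  rw [h1, abs_mul, abs_of_nonneg (by positivity : 0 ≤ 1 / (n : ℝ))]
  calc 1 / (n : ℝ) * |∑ i, ∫ z, (F x z - F y z) ∂(loc i)|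
      ≤ 1 / (n : ℝ) * ∑ _i : Fin n, G * ‖x - y‖ := by
        gcongr
        exact (Finset.abs_sum_le_sum_abs _ _).trans (Finset.sum_le_sum fun i _ => h2 i)
    _ = G * ‖x - y‖ := by simp; field_simp

theorem continuousOn_objective (hn : 0 < n) (hloc : ∀ i, IsProbabilityMeasure (loc i))
    (hint : ∀ x ∈ X, ∀ i, Integrable (F x) (loc i)) {G : ℝ} (hG : 0 ≤ G)
    (hLip : ∀ i, ∀ᵐ z ∂(loc i), ∀ x ∈ X, ∀ y ∈ X, |F x z - F y z| ≤ G * ‖x - y‖) :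
    ContinuousOn (objective F loc) X := by
  refine (LipschitzOnWith.of_dist_le_mul (K := ⟨G, hG⟩) fun x hx y hy => ?_).continuousOn
  rw [Real.dist_eq, dist_eq_norm]
  exact abs_objective_sub_le hn hloc hint hLip hx hy

variable [NormedSpace ℝ E]

theorem convexOn_objective (hX : Convex ℝ X) (hF : ∀ z, ConvexOn ℝ X fun x => F x z)
    (hint : ∀ x ∈ X, ∀ i, Integrable (F x) (loc i)) : ConvexOn ℝ X (objective F loc) := by
  refine ⟨hX, fun x hx y hy a b ha hb hab => ?_⟩
  unfold objective
  have h : ∀ i, ∫ z, F (a • x + b • y) z ∂(loc i)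
      ≤ a * ∫ z, F x z ∂(loc i) + b * ∫ z, F y z ∂(loc i) := fun i => by
    rw [← integral_const_mul, ← integral_const_mul,
      ← integral_add ((hint x hx i).const_mul a) ((hint y hy i).const_mul b)]
    exact integral_mono (hint _ (hX hx hy ha hb hab) i)
      (((hint x hx i).const_mul a).add ((hint y hy i).const_mul b))
      fun z => (hF z).2 hx hy ha hb hab
  have h2 := Finset.sum_le_sum fun i (_ : i ∈ Finset.univ) => h i
  rw [Finset.sum_add_distrib, ← Finset.mul_sum, ← Finset.mul_sum] at h2
  have h3 := mul_le_mul_of_nonneg_left h2 (by positivity : 0 ≤ 1 / (n : ℝ))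
  simp only [smul_eq_mul]
  linarith

theorem average_mem (hX : Convex ℝ X) {x : ℕ → E} (hx : ∀ t, 1 ≤ t → x t ∈ X) {T : ℕ}
    (hT : 1 ≤ T) : average x T ∈ X := by
  have hT0 : (0 : ℝ) < T := by exact_mod_cast hT
  unfold average
  rw [Finset.smul_sum]
  exact hX.sum_mem (fun _ _ => by positivity) (by simp; field_simp)
    fun t ht => hx t (Finset.mem_Icc.1 ht).1

theorem mul_average_le {f : E → ℝ} (hf : ConvexOn ℝ X f) {x : ℕ → E} (hx : ∀ t, 1 ≤ t → x t ∈ X)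
    {T : ℕ} (hT : 1 ≤ T) (b : ℝ) :
    T * (f (average x T) - b) ≤ ∑ s ∈ Finset.range T, (f (x (s + 1)) - b) := by
  have hT0 : (0 : ℝ) < T := by exact_mod_cast hT
  have h := hf.map_sum_le (t := Finset.range T) (w := fun _ => 1 / (T : ℝ))
    (p := fun s => x (s + 1)) (fun _ _ => by positivity) (by simp; field_simp)
    fun s _ => hx _ (by omega)
  have h1 : average x T = ∑ s ∈ Finset.range T, (1 / (T : ℝ)) • x (s + 1) := by
    unfold average
    rw [← Finset.smul_sum, show Finset.Icc 1 T = Finset.Ico 1 (T + 1) by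
      ext; simp only [Finset.mem_Icc, Finset.mem_Ico]; omega,
      Finset.sum_Ico_eq_sum_range]
    simp only [Nat.add_sub_cancel, add_comm 1]
  rw [← h1] at h
  simp only [smul_eq_mul, ← Finset.mul_sum] at h
  rw [Finset.sum_sub_distrib, mul_sub]
  simp only [Finset.sum_const, Finset.card_range, nsmul_eq_mul]
  have h2 := mul_le_mul_of_nonneg_left h hT0.le
  rw [← mul_assoc, mul_one_div_cancel hT0.ne', one_mul] at h2
  linarith

end Objective

/-! ### Choice of the mixing time and bookkeeping of constants. -/

section Constants

/-- The number of steps after which the token has mixed up to precision `4 ε`. -/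
theorem exists_mixing_time {n : ℕ} (hn : 2 ≤ n) {lam ε Δ : ℝ} (h0 : 0 ≤ lam) (h1 : lam < 1)
    (hε : 0 < ε) (hε4 : ε < 1 / 4) (hΔ : 0 ≤ Δ) :
    ∃ p : ℕ, 1 ≤ p ∧ √(n * lam ^ p) ≤ 4 * ε ∧
      (p : ℝ) ≤ 2 * ((Real.log (n / ε) + Δ) / (1 - lam)) ∧
      2 ≤ (Real.log (n / ε) + Δ) / (1 - lam) := by
  have hgap : 0 < 1 - lam := by linarith
  have hn0 : (0 : ℝ) < n := by exact_mod_cast (by omega : 0 < n)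
  have hn2 : (2 : ℝ) ≤ n := by exact_mod_cast hn
  have hlog2 : 0.6931471803 < Real.log 2 := Real.log_two_gt_d9
  have hlogn : Real.log 2 ≤ Real.log n := Real.log_le_log (by norm_num) hn2
  have hlog4 : Real.log 4 = 2 * Real.log 2 := by
    rw [show (4 : ℝ) = 2 ^ 2 by norm_num, Real.log_pow]; norm_num
  have hlogε : Real.log ε < - Real.log 4 := by
    rw [← Real.log_inv]; exact Real.log_lt_log hε (by linarith)
  have hlog4ε : Real.log (4 * ε) = Real.log 4 + Real.log ε :=
    Real.log_mul (by norm_num) hε.ne'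
  have hlognε : Real.log (n / ε) = Real.log n - Real.log ε := Real.log_div hn0.ne' hε.ne'
  -- Solves `n * exp (-(1 - lam) * q) = (4 * ε) ^ 2`; since `lam ≤ exp (-(1 - lam))`, `⌈q⌉₊` steps
  -- suffice. It is positive because `ε < 1 / 4`.
  set q : ℝ := (Real.log n - 2 * Real.log (4 * ε)) / (1 - lam) with hq
  have hq0 : 0 < q := div_pos (by linarith) hgap
  refine ⟨⌈q⌉₊, Nat.one_le_ceil_iff.2 hq0, ?_, ?_, ?_⟩
  · rw [Real.sqrt_le_left (by positivity)]
    have h2 : lam ^ ⌈q⌉₊ ≤ Real.exp (-(1 - lam)) ^ ⌈q⌉₊ :=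
      pow_le_pow_left₀ h0 (by have := Real.add_one_le_exp (-(1 - lam)); linarith) _
    have h3 : (Real.log n - 2 * Real.log (4 * ε)) ≤ ⌈q⌉₊ * (1 - lam) := by
      have := Nat.le_ceil q
      rwa [hq, div_le_iff₀ hgap, ← hq] at this
    calc n * lam ^ ⌈q⌉₊ ≤ n * Real.exp (-(1 - lam)) ^ ⌈q⌉₊ := by gcongr
      _ = Real.exp (Real.log n + ⌈q⌉₊ * (-(1 - lam))) := by
          rw [Real.exp_add, Real.exp_log hn0, ← Real.exp_nat_mul]
      _ ≤ Real.exp (Real.log (4 * ε) + Real.log (4 * ε)) := by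
          apply Real.exp_le_exp.2; linarith
      _ = (4 * ε) ^ 2 := by rw [Real.exp_add, Real.exp_log (by positivity)]; ring
  -- The `1` lost in rounding up is paid for by the `-2 * log 4` in the numerator of `q`.
  · have h2 := (Nat.ceil_lt_add_one hq0.le).le
    refine h2.trans ?_
    rw [hq, div_add_one hgap.ne', ← mul_div_assoc]
    gcongr
    linarith
  -- Here `n ≥ 2` and `ε < 1 / 4` give `log (n / ε) ≥ 3 * log 2 > 2`.
  · rw [le_div_iff₀ hgap]
    nlinarith

/-- Comparison of the bound obtained with mixing time `p` with the stated one. -/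
theorem bound_le_of_mixing {R G a ε T p K M D Z N : ℝ} (hR : 0 ≤ R) (hG : 0 ≤ G)
    (ha : 0 < a) (hε : 0 < ε) (hT : 0 < T) (hp : 1 ≤ p) (hpK : p ≤ 2 * K) (hD : 0 ≤ D)
    (hDM : D ≤ M) (hM : 1 / 2 ≤ M) (hKM : 16 * (K * M) ≤ T) (hNT : N ≤ T)
    (hZ : T * Z ≤ (p - 1) * (G * R) + N * (4 * ε * (G * R)) + G * R * √(2 * p * T * D)
      + ((2 * (p - 1) + 1) * (a * G ^ 2 * √T) + √T / a * (1 / 2 * R ^ 2))) :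
    Z ≤ 4 * (R ^ 2 / (a * √T) + K * (G ^ 2 * a / √T) + ε * G * R + G * R / √T * √(K * M)) := by
  have hK : 0 < K := by linarith
  have hsT : 0 < √T := Real.sqrt_pos.2 hT
  have hTT : √T * √T = T := Real.mul_self_sqrt hT.le
  have hGR : 0 ≤ G * R := mul_nonneg hG hR
  have h1 : √(2 * p * T * D) ≤ 2 * (√T * √(K * M)) := by
    rw [← Real.sqrt_mul hT.le, Real.sqrt_le_left (by positivity), mul_pow,
      Real.sq_sqrt (by positivity)]
    have : p * D ≤ 2 * K * M := mul_le_mul hpK hDM hD (by positivity)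
    nlinarith
  -- The discarded rounds are absorbed by the deviation term: `16 * (K * M) ≤ T` and `M ≥ 1 / 2`
  -- give `K² ≤ T * K * M`.
  have h2 : p - 1 ≤ 2 * (√T * √(K * M)) := by
    have h3 : K ≤ √T * √(K * M) := by
      rw [← Real.sqrt_mul hT.le]
      apply Real.le_sqrt_of_sq_le
      have h4 : 16 * (K * M) * (K * M) ≤ T * (K * M) :=
        mul_le_mul_of_nonneg_right hKM (by positivity)
      have h5 : K ^ 2 * 1 ≤ K ^ 2 * (16 * (M * M)) := by
        gcongr; nlinarith
      nlinarith
    linarith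
  have h3 : T * Z ≤ T * (4 * (R ^ 2 / (a * √T) + K * (G ^ 2 * a / √T) + ε * G * R
      + G * R / √T * √(K * M))) := by
    have h4 : T * (4 * (R ^ 2 / (a * √T) + K * (G ^ 2 * a / √T) + ε * G * R
        + G * R / √T * √(K * M)))
        = 4 * (√T / a * R ^ 2 + K * (a * G ^ 2 * √T) + T * (ε * (G * R))
        + G * R * (√T * √(K * M))) := by
      have h5 : T * (1 / √T) = √T := by rw [mul_one_div, div_eq_iff hsT.ne', hTT]
      calc T * (4 * (R ^ 2 / (a * √T) + K * (G ^ 2 * a / √T) + ε * G * R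
            + G * R / √T * √(K * M)))
          = 4 * (T * (1 / √T) / a * R ^ 2 + K * (a * G ^ 2 * (T * (1 / √T))) + T * (ε * (G * R))
            + G * R * (T * (1 / √T) * √(K * M))) := by ring
        _ = _ := by rw [h5]
    rw [h4]
    -- The constant `4` is the allowance `4 * ε` in the bias, the drift factor `2 * p - 1 ≤ 4 * K`,
    -- and `2 + 2` from the deviation and the discarded rounds.
    have h5 : G * R * √(2 * p * T * D) ≤ G * R * (2 * (√T * √(K * M))) := by gcongr
    have h6 : (p - 1) * (G * R) ≤ 2 * (√T * √(K * M)) * (G * R) := by gcongr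
    have h7 : N * (4 * ε * (G * R)) ≤ T * (4 * ε * (G * R)) := by gcongr
    have h8 : (2 * (p - 1) + 1) * (a * G ^ 2 * √T) ≤ 4 * K * (a * G ^ 2 * √T) := by
      gcongr; linarith
    have h9 : 0 ≤ √T / a * R ^ 2 := by positivity
    nlinarith
  exact le_of_mul_le_mul_left h3 hT

end Constants

/-! ### The iterates as random variables. -/

section Iterates

variable {E Ξ Ω : Type*} [NormedAddCommGroup E] [NormedSpace ℝ E] {ξ : ℕ → Ω → Ξ} {X : Set E}
  {ψ : E → ℝ} {sg : E → Ξ → E →L[ℝ] ℝ} {x : ℕ → Ω → E} {x₁ : E} {a : ℝ}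

theorem iterate_mem (hx₁ : x₁ ∈ X) (hx1 : ∀ ω, x 1 ω = x₁)
    (hstep : ∀ t : ℕ, 1 ≤ t → ∀ ω, IsMirrorStep ψ X (a / √(t : ℝ)) (sg (x t ω) (ξ t ω)) (x t ω)
      (x (t + 1) ω)) (ω : Ω) : ∀ t, 1 ≤ t → x t ω ∈ X := by
  intro t ht
  obtain ⟨s, rfl⟩ : ∃ s, t = s + 1 := ⟨t - 1, by omega⟩
  rcases Nat.eq_zero_or_pos s with rfl | hs
  · rw [zero_add, hx1]; exact hx₁
  · exact (hstep s hs ω).1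

variable [FiniteDimensional ℝ E] [MeasurableSpace E] [BorelSpace E] [MeasurableSpace Ξ] {n : ℕ}
  {P : ℕ → Ω → Matrix (Fin n) (Fin n) ℝ} {token : ℕ → Ω → Fin n}

/-- The iterate `x (s + 1)` uses only the samples up to time `s`; this shift permits conditioning on
the history at `s`. The subgradient selection is measurable only over `X`, so the iterates are
viewed in the subtype. -/
theorem measurable_iterate (hψ : DifferentiableOn ℝ ψ X) (hψc : StrongConvexOn X 1 ψ)
    (ha : 0 < a) (hsg : Measurable fun q : X × Ξ => sg q.1 q.2)
    (hx₁ : x₁ ∈ X) (hx1 : ∀ ω, x 1 ω = x₁)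
    (hstep : ∀ t : ℕ, 1 ≤ t → ∀ ω, IsMirrorStep ψ X (a / √(t : ℝ)) (sg (x t ω) (ξ t ω)) (x t ω)
      (x (t + 1) ω)) (s : ℕ) : Measurable[history P token ξ s] (x (s + 1)) := by
  induction s with
  | zero =>
    have : x (0 + 1) = fun _ => x₁ := funext hx1
    rw [this]; exact measurable_const
  | succ s ih =>
    have hxm : Measurable[history P token ξ (s + 1)] (x (s + 1)) :=
      ih.mono (history_mono (Nat.le_succ s)) le_rfl
    have hxX : ∀ ω, x (s + 1) ω ∈ X := fun ω => iterate_mem hx₁ hx1 hstep ω _ (by omega)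
    have hg : Measurable[history P token ξ (s + 1)]
        fun ω => sg (x (s + 1) ω) (ξ (s + 1) ω) :=
      hsg.comp (Measurable.prodMk (hxm.subtype_mk (h := hxX))
        (measurable_sample_history (by omega) le_rfl))
    exact @measurable_mirrorStep Ω E (history P token ξ (s + 1)) _ _ _ X ψ _ _ hψ hψc _
      (div_pos ha (Real.sqrt_pos.2 (by positivity))) _ _ _ hg hxm hxX (hstep (s + 1) (by omega))

end Iterates

/-! ### The probabilistic bound for a fixed mixing time. -/

section Main

variable {E : Type*} [NormedAddCommGroup E] [NormedSpace ℝ E] [FiniteDimensional ℝ E]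
  [MeasurableSpace E] [BorelSpace E] {Ξ : Type*} [MeasurableSpace Ξ]
  {Ω : Type*} [MeasurableSpace Ω] {μ : Measure Ω} {n : ℕ}
  {loc : Fin n → Measure Ξ} {P : ℕ → Ω → Matrix (Fin n) (Fin n) ℝ} {token : ℕ → Ω → Fin n}
  {ξ : ℕ → Ω → Ξ} {X : Set E} {ψ : E → ℝ} {F : E → Ξ → ℝ} {sg : E → Ξ → E →L[ℝ] ℝ}
  {x : ℕ → Ω → E} {x₁ : E} {R G a : ℝ}

/-- High-probability bound on the sum of the optimality gaps, for a fixed competitor `xs` and a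
fixed mixing time `p`. -/
theorem measureReal_sum_gap_ge [IsProbabilityMeasure μ] (hn : 2 ≤ n)
    (hloc : ∀ i, IsProbabilityMeasure (loc i))
    (h : IsRandomMIGDSampling μ loc P token ξ) (hlam : lambdaTwo hn μ (P 1) < 1)
    (hψ : DifferentiableOn ℝ ψ X) (hψc : StrongConvexOn X 1 ψ) (hR : 0 ≤ R)
    (hD : ∀ x ∈ X, ∀ y ∈ X, bregman ψ X x y ≤ 1 / 2 * R ^ 2)
    (hF : ∀ x ∈ X, Measurable (F x)) (hint : ∀ x ∈ X, ∀ i, Integrable (F x) (loc i))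
    (hLip : ∀ i, ∀ᵐ z ∂(loc i), ∀ x ∈ X, ∀ y ∈ X, |F x z - F y z| ≤ G * ‖x - y‖)
    (hsg : Measurable fun q : X × Ξ => sg q.1 q.2)
    (hsub : ∀ z, ∀ x ∈ X, IsSubgradientOn (fun y => F y z) X x (sg x z))
    (hsgG : ∀ i, ∀ᵐ z ∂(loc i), ∀ x ∈ X, ‖sg x z‖ ≤ G) (ha : 0 < a)
    (hx₁ : x₁ ∈ X) (hx1 : ∀ ω, x 1 ω = x₁)
    (hstep : ∀ t : ℕ, 1 ≤ t → ∀ ω, IsMirrorStep ψ X (a / √(t : ℝ)) (sg (x t ω) (ξ t ω)) (x t ω)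
      (x (t + 1) ω)) {xs : E} (hxs : xs ∈ X) (hG : 0 ≤ G) (hGR : 0 < G * R) {p : ℕ} (hp : 1 ≤ p)
    {N : ℕ} (hN : 0 < N) {γ : ℝ} (hγ : 0 ≤ γ) :
    1 - Real.exp (-(γ ^ 2 / (2 * ((G * R) ^ 2 * p * (N + p - 1 : ℕ)))))
      ≤ μ.real {ω | ∑ s ∈ Finset.range N, (objective F loc (x (s + 1) ω) - objective F loc xs)
        ≤ N * (√(n * lambdaTwo hn μ (P 1) ^ p) * (G * R)) + γ
          + ((2 * (p - 1) + 1) * (a * G ^ 2 * √(N : ℝ))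
            + √((N + p - 1 : ℕ) : ℝ) / a * (1 / 2 * R ^ 2))} := by
  have : ProperSpace E := FiniteDimensional.proper_real E
  obtain ⟨A, hA, hA0, hAq⟩ := exists_measurableSet_of_ae
    (fun i => (hLip i).and (hsgG i))
  have hdiam : ∀ x ∈ X, ∀ y ∈ X, ‖x - y‖ ≤ R := fun x hx y hy =>
    norm_sub_le_of_bregman_le hψ hψc hR hD hx hy
  -- Cutting the loss difference off outside `A` makes it bounded and continuous for every sample,
  -- and changes nothing almost surely. Continuity in the point and measurability in the sample then
  -- yield joint measurability.
  let H : X → Ξ → ℝ := fun y z => A.indicator (fun z => F y z - F xs z) z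
  have hHc : ∀ y z, |H y z| ≤ G * R := fun y z => by
    by_cases hz : z ∈ A
    · simp only [H, Set.indicator_of_mem hz]
      exact ((hAq z hz).1 y y.2 xs hxs).trans (by gcongr; exact hdiam _ y.2 _ hxs)
    · simp only [H, Set.indicator_of_notMem hz, abs_zero]; exact hGR.le
  have hHcont : ∀ z, Continuous fun y => H y z := fun z => by
    by_cases hz : z ∈ A
    · simp only [H, Set.indicator_of_mem hz]
      refine Continuous.sub ?_ continuous_const
      refine (LipschitzWith.of_dist_le_mul (K := ⟨G, hG⟩) fun y y' => ?_).continuous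
      rw [Real.dist_eq, Subtype.dist_eq, dist_eq_norm]
      exact (hAq z hz).1 y y.2 y' y'.2
    · simp only [H, Set.indicator_of_notMem hz]; exact continuous_const
  have hH : Measurable fun q : X × Ξ => H q.1 q.2 :=
    measurable_uncurry_of_continuous_of_measurable hHcont fun y =>
      ((hF y y.2).sub (hF xs hxs)).indicator hA
  have hHint : ∀ (y : X) i, ∫ z, H y z ∂(loc i) = ∫ z, F y z ∂(loc i) - ∫ z, F xs z ∂(loc i) := by
    intro y i
    rw [← integral_sub (hint y y.2 i) (hint xs hxs i)]
    refine integral_congr_ae ?_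
    have hmem : ∀ᵐ z ∂(loc i), z ∉ Aᶜ := measure_eq_zero_iff_ae_notMem.1 (hA0 i)
    filter_upwards [hmem] with z hz
    simp only [H, Set.indicator_of_mem (Set.notMem_compl_iff.1 hz)]
  have hobj : ∀ y : X, objective F loc y - objective F loc xs
      = 1 / (n : ℝ) * ∑ i, ∫ z, H y z ∂(loc i) := fun y => by
    simp_rw [hHint, Finset.sum_sub_distrib, mul_sub]; rfl
  let V : X → Fin n → ℝ := fun y j => ∫ z, H y z ∂(loc j)
  have hVc : ∀ y j, |V y j| ≤ G * R := fun y j => by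
    have := norm_integral_le_of_norm_le_const (μ := loc j) (f := fun z => H y z) (C := G * R)
      (Filter.Eventually.of_forall fun z => hHc y z)
    simpa using this
  have hVm : ∀ j, Measurable fun y => V y j := fun j =>
    (hH.stronglyMeasurable.integral_prod_right (ν := loc j)).measurable
  have hxX := iterate_mem hx₁ hx1 hstep
  let y : ℕ → Ω → X := fun s ω => ⟨x (s + 1) ω, hxX ω _ (by omega)⟩
  have hy : ∀ s, Measurable[history P token ξ s] (y s) := fun s =>
    (measurable_iterate hψ hψc ha hsg hx₁ hx1 hstep s).subtype_mk
  have hm1 := h.measurable_matrix 1 le_rfl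
  have hds1 := h.doublyStochastic 1 le_rfl
  set A' := meanMatrix μ (P 1) ^ p with hA'
  have hA'ds : A' ∈ doublyStochastic ℝ (Fin n) :=
    pow_mem (meanMatrix_mem_doublyStochastic hm1 hds1) p
  -- The minus signs make `Y s - M s` the conditional mean minus the realised loss, so the upper
  -- tail is the one that is needed.
  let Y : ℕ → Ω → ℝ := fun s ω => -H (y s ω) (ξ (s + p) ω)
  let M : ℕ → Ω → ℝ := fun s ω => -(A' *ᵥ V (y s ω)) (token s ω)
  have hYm : ∀ s, Measurable[history P token ξ (s + p)] (Y s) := fun s =>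
    (hH.comp (((hy s).mono (history_mono (Nat.le_add_right s p)) le_rfl).prodMk
      (measurable_sample_history (by omega) le_rfl))).neg
  have hMm : ∀ s, Measurable[history P token ξ s] (M s) := fun s => by
    have h1 : ∀ i, Measurable fun v : X => (A' *ᵥ V v) i := fun i => by
      simp only [Matrix.mulVec, dotProduct]
      exact Finset.measurable_sum _ fun j _ => (hVm j).const_mul _
    have h2 : Measurable fun q : X × Fin n => (A' *ᵥ V q.1) q.2 :=
      measurable_from_prod_countable_left h1
    exact (h2.comp ((hy s).prodMk (measurable_token_history le_rfl))).neg
  have hYc : ∀ s ω, |Y s ω| ≤ G * R := fun s ω => by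
    simp only [Y, abs_neg]; exact hHc _ _
  have hMc : ∀ s ω, |M s ω| ≤ G * R := fun s ω => by
    simp only [M, abs_neg]
    exact abs_mulVec_le_of_mem_doublyStochastic hA'ds (hVc _) _
  have hcond : ∀ s, ∀ W : Ω → ℝ, Measurable[history P token ξ s] W →
      (∃ B, ∀ ω, |W ω| ≤ B) → ∫ ω, W ω * Y s ω ∂μ = ∫ ω, W ω * M s ω ∂μ := by
    rintro s W hW ⟨B, hB⟩
    simp only [Y, M, mul_neg, integral_neg]
    rw [h.integral_mul_sample hloc s hp (hy s) hH hHc hW hB]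
  have hconc := measure_sum_sub_ge_le (μ := μ) history_mono h.history_le hp hGR hYm hMm hYc hMc
    hcond hN hγ
  have hmeas : MeasurableSet {ω | γ ≤ ∑ s ∈ Finset.range N, (Y s ω - M s ω)} :=
    measurableSet_le measurable_const (Finset.measurable_sum _ fun s _ =>
      ((hYm s).mono (h.history_le _) le_rfl).sub ((hMm s).mono (h.history_le _) le_rfl))
  have hcompl := probReal_compl_eq_one_sub (μ := μ) hmeas
  have hae := h.ae_sample_mem hA hA0
  refine (show _ ≤ μ.real {ω | γ ≤ ∑ s ∈ Finset.range N, (Y s ω - M s ω)}ᶜ by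
    rw [hcompl]; linarith).trans ?_
  refine ENNReal.toReal_mono (measure_ne_top _ _) (measure_mono_ae ?_)
  filter_upwards [hae] with ω hω hbad
  have hlt : ∑ s ∈ Finset.range N, (Y s ω - M s ω) < γ := not_le.1 hbad
  have hpath := sum_delayed_loss_le hψ hψc hD ha hG (hxX ω)
    (fun t ht => (hAq _ (hω t ht)).2 _ (hxX ω t ht)) (fun t ht => hstep t ht ω)
    (φ := fun t y => F y (ξ t ω)) (fun t ht => (hAq _ (hω t ht)).1)
    (fun t ht => hsub _ _ (hxX ω t ht)) hp hxs N
  -- The split into mixing bias, fluctuation and realised loss; on the good event the cut-off in `H`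
  -- is inactive.
  have hterm : ∀ s, objective F loc (x (s + 1) ω) - objective F loc xs
      ≤ √(n * lambdaTwo hn μ (P 1) ^ p) * (G * R) + (Y s ω - M s ω)
        + (F (x (s + 1) ω) (ξ (s + p) ω) - F xs (ξ (s + p) ω)) := fun s => by
    have h1 := abs_meanMatrix_pow_mulVec_sub_le hn hm1 hds1 hlam (hVc (y s ω)) p (token s ω)
    have h2 := hobj (y s ω)
    have h3 : Y s ω = -(F (x (s + 1) ω) (ξ (s + p) ω) - F xs (ξ (s + p) ω)) := by
      simp only [Y, H, Set.indicator_of_mem (hω (s + p) (by omega)), y]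
    have h4 : M s ω = -(meanMatrix μ (P 1) ^ p *ᵥ V (y s ω)) (token s ω) := rfl
    have h5 := (abs_le.1 h1).1
    change objective F loc (x (s + 1) ω) - objective F loc xs = _ at h2
    rw [h2, h3, h4]
    linarith
  have hsum := Finset.sum_le_sum fun s (_ : s ∈ Finset.range N) => hterm s
  rw [Finset.sum_add_distrib, Finset.sum_add_distrib, Finset.sum_const, Finset.card_range,
    nsmul_eq_mul] at hsum
  change ∑ s ∈ Finset.range N, (objective F loc (x (s + 1) ω) - objective F loc xs) ≤ _
  linarith

end Main

/-! ### The averaged iterate, and uniformity over `ε` and the competitor. -/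

section Main

variable {E : Type*} [NormedAddCommGroup E] [NormedSpace ℝ E] [FiniteDimensional ℝ E]
  [MeasurableSpace E] [BorelSpace E] {Ξ : Type*} [MeasurableSpace Ξ]
  {Ω : Type*} [MeasurableSpace Ω] {μ : Measure Ω} {n : ℕ}
  {loc : Fin n → Measure Ξ} {P : ℕ → Ω → Matrix (Fin n) (Fin n) ℝ} {token : ℕ → Ω → Fin n}
  {ξ : ℕ → Ω → Ξ} {X : Set E} {ψ : E → ℝ} {F : E → Ξ → ℝ} {sg : E → Ξ → E →L[ℝ] ℝ}
  {x : ℕ → Ω → E} {x₁ : E} {R G a : ℝ}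

/-- The right-hand side of the bound, with `gap = 1 - λ₂`. -/
noncomputable def migdBound (n T : ℕ) (R G a δ gap ε : ℝ) : ℝ :=
  4 * (R ^ 2 / (a * √(T : ℝ))
    + (Real.log (n / ε) + Real.log (T / δ)) / gap * (G ^ 2 * a / √(T : ℝ))
    + ε * G * R
    + G * R / √(T : ℝ) * √(Real.log (T * n / (ε * δ))
        * Real.log (1 / δ * Real.log (T * n / (ε * δ)) / gap) / gap))

theorem log_add_log_eq {n T : ℕ} (hn : 0 < n) (hT : 0 < T) {δ ε : ℝ} (hδ : 0 < δ) (hε : 0 < ε) :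
    Real.log (n / ε) + Real.log (T / δ) = Real.log (T * n / (ε * δ)) := by
  have hn0 : (0 : ℝ) < n := by exact_mod_cast hn
  have hT0 : (0 : ℝ) < T := by exact_mod_cast hT
  rw [← Real.log_mul (by positivity) (by positivity)]
  congr 1; field_simp

/-- The upper limit on `ε` serves here: it keeps the coefficient of the drift term nonnegative. -/
theorem log_nonneg_of_lt {n T : ℕ} {δ ε : ℝ} (hδ : 0 < δ) (hε : 0 < ε) (hεn : ε < n * T / δ) :
    0 ≤ Real.log (T * n / (ε * δ)) := by
  refine Real.log_nonneg ?_
  rw [lt_div_iff₀ hδ] at hεn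
  rw [one_le_div (by positivity)]
  linarith

theorem migdBound_nonneg {n T : ℕ} (hn : 0 < n) (hT : 0 < T) {δ ε gap : ℝ} (hR : 0 ≤ R)
    (hG : 0 ≤ G) (ha : 0 < a) (hδ : 0 < δ) (hgap : 0 < gap) (hε : 0 < ε)
    (hεn : ε < n * T / δ) : 0 ≤ migdBound n T R G a δ gap ε := by
  unfold migdBound
  rw [log_add_log_eq hn hT hδ hε]
  have := log_nonneg_of_lt hδ hε hεn
  positivity

/-- The bound for the average iterate, for one `ε` and one competitor `xs`. -/
theorem measureReal_average_ge [IsProbabilityMeasure μ] (hn : 2 ≤ n)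
    (hloc : ∀ i, IsProbabilityMeasure (loc i))
    (h : IsRandomMIGDSampling μ loc P token ξ) (hlam : lambdaTwo hn μ (P 1) < 1)
    (hψ : DifferentiableOn ℝ ψ X) (hψc : StrongConvexOn X 1 ψ) (hR : 0 ≤ R)
    (hD : ∀ x ∈ X, ∀ y ∈ X, bregman ψ X x y ≤ 1 / 2 * R ^ 2)
    (hFc : ∀ z, ConvexOn ℝ X fun x => F x z)
    (hF : ∀ x ∈ X, Measurable (F x)) (hint : ∀ x ∈ X, ∀ i, Integrable (F x) (loc i))
    (hLip : ∀ i, ∀ᵐ z ∂(loc i), ∀ x ∈ X, ∀ y ∈ X, |F x z - F y z| ≤ G * ‖x - y‖)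
    (hsg : Measurable fun q : X × Ξ => sg q.1 q.2)
    (hsub : ∀ z, ∀ x ∈ X, IsSubgradientOn (fun y => F y z) X x (sg x z))
    (hsgG : ∀ i, ∀ᵐ z ∂(loc i), ∀ x ∈ X, ‖sg x z‖ ≤ G) (hG : 0 ≤ G) (ha : 0 < a)
    (hx₁ : x₁ ∈ X) (hx1 : ∀ ω, x 1 ω = x₁)
    (hstep : ∀ t : ℕ, 1 ≤ t → ∀ ω, IsMirrorStep ψ X (a / √(t : ℝ)) (sg (x t ω) (ξ t ω)) (x t ω)
      (x (t + 1) ω)) {xs : E} (hxs : xs ∈ X) {T : ℕ} (hT : 1 ≤ T) {δ : ℝ} (hδ : 0 < δ)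
    (hδ1 : δ ≤ 1) {ε : ℝ} (hε : 0 < ε) (hεn : ε < n * T / δ) :
    1 - δ ≤ μ.real {ω | objective F loc (average (fun t => x t ω) T) - objective F loc xs
      ≤ migdBound n T R G a δ (1 - lambdaTwo hn μ (P 1)) ε} := by
  have hn0 : 0 < n := by omega
  have hxX := iterate_mem hx₁ hx1 hstep
  have hgapR : ∀ y ∈ X, objective F loc y - objective F loc xs ≤ G * R := fun y hy =>
    (le_abs_self _).trans ((abs_objective_sub_le hn0 hloc hint hLip hy hxs).trans
      (by gcongr; exact norm_sub_le_of_bregman_le hψ hψc hR hD hy hxs))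
  set lam := lambdaTwo hn μ (P 1) with hlamdef
  -- No gap exceeds `G * R`. If the bound is smaller than that, so is each of its nonnegative terms:
  -- the bias term yields `ε < 1 / 4`, the deviation term `16 * (K * M) ≤ T`.
  by_cases htriv : G * R ≤ migdBound n T R G a δ (1 - lam) ε
  · have huniv : {ω | objective F loc (average (fun t => x t ω) T) - objective F loc xs
      ≤ migdBound n T R G a δ (1 - lam) ε} = Set.univ :=
      Set.eq_univ_of_forall fun ω =>
        (hgapR _ (average_mem hψc.1 (hxX ω) hT)).trans htriv
    rw [huniv, probReal_univ]; linarith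
  rw [not_le] at htriv
  have hlam0 : 0 ≤ lam :=
    lambdaTwo_nonneg hn (h.measurable_matrix 1 le_rfl) (h.doublyStochastic 1 le_rfl)
  have hgap : 0 < 1 - lam := by linarith
  have hGR : 0 < G * R := (migdBound_nonneg hn0 hT hR hG ha hδ hgap hε hεn).trans_lt htriv
  have hT0 : (0 : ℝ) < T := by exact_mod_cast hT
  have hT1 : (1 : ℝ) ≤ T := by exact_mod_cast hT
  have hsT : 0 < √(T : ℝ) := Real.sqrt_pos.2 hT0
  set D := Real.log (1 / δ) with hDdef
  have hD0 : 0 ≤ D := Real.log_nonneg (by rw [one_le_div hδ]; exact hδ1)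
  have hlogT : 0 ≤ Real.log (T / δ) := Real.log_nonneg (by rw [one_le_div hδ]; linarith)
  have hL0 := log_nonneg_of_lt hδ hε hεn
  set L := Real.log (T * n / (ε * δ)) with hL
  set K := L / (1 - lam) with hK
  set M := Real.log (1 / δ * L / (1 - lam)) with hM
  have hbound : migdBound n T R G a δ (1 - lam) ε = 4 * (R ^ 2 / (a * √(T : ℝ))
      + K * (G ^ 2 * a / √(T : ℝ)) + ε * G * R + G * R / √(T : ℝ) * √(K * M)) := by
    unfold migdBound
    rw [log_add_log_eq hn0 hT hδ hε, ← hL, ← hM, hK, div_mul_eq_mul_div L (1 - lam) M]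
  have hK0 : 0 ≤ K := div_nonneg hL0 hgap.le
  have hterms : 4 * (ε * (G * R)) < G * R ∧ 4 * (G * R / √(T : ℝ) * √(K * M)) < G * R := by
    rw [hbound] at htriv
    have h1 : 0 ≤ R ^ 2 / (a * √(T : ℝ)) := by positivity
    have h2 : 0 ≤ K * (G ^ 2 * a / √(T : ℝ)) := by positivity
    have h3 : 0 ≤ ε * G * R := by positivity
    have h4 : 0 ≤ G * R / √(T : ℝ) * √(K * M) := by positivity
    constructor <;> linarith
  have hε4 : ε < 1 / 4 := by
    have := hterms.1
    by_contra hcon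
    rw [not_lt] at hcon
    nlinarith
  obtain ⟨p, hp, hmix, hpK, hK2⟩ := exists_mixing_time hn hlam0 hlam hε hε4 hlogT
  rw [log_add_log_eq hn0 hT hδ hε, ← hL, ← hK] at hpK hK2
  have hMeq : M = D + Real.log K := by
    rw [hM, hDdef, mul_div_assoc, ← hK, Real.log_mul (by positivity) (by linarith)]
  have hlogK : 1 / 2 ≤ Real.log K := by
    have h1 : Real.log 2 ≤ Real.log K := Real.log_le_log (by norm_num) hK2
    have h2 := Real.log_two_gt_d9
    linarith
  have hM2 : 1 / 2 ≤ M := by linarith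
  have hKM : 16 * (K * M) ≤ T := by
    have h1 : √(16 * (K * M)) ≤ √(T : ℝ) := by
      rw [Real.sqrt_mul (by norm_num), show (16 : ℝ) = 4 ^ 2 by norm_num,
        Real.sqrt_sq (by norm_num)]
      have h2 : 4 * (G * R / √(T : ℝ) * √(K * M)) = G * R * (4 * √(K * M) / √(T : ℝ)) := by ring
      have h3 : 4 * √(K * M) / √(T : ℝ) < 1 := by
        have := hterms.2
        rw [h2] at this
        exact (mul_lt_iff_lt_one_right hGR).1 this
      rw [div_lt_one hsT] at h3
      exact h3.le
    exact (Real.sqrt_le_sqrt_iff hT0.le).1 h1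
  -- From `p ≤ 2 * K`, `M ≥ 1 / 2` and `16 * (K * M) ≤ T`.
  have hpT : p < T := by
    have h1 : (p : ℝ) < T := by nlinarith
    exact_mod_cast h1
  -- For `s < N` the sample index `s + p` is at most `N + p - 1 = T`; the remaining `p - 1` iterates
  -- have no such delayed sample within the horizon.
  obtain ⟨N, hN⟩ : ∃ N, N + p = T + 1 := ⟨T + 1 - p, by omega⟩
  have hN0 : 0 < N := by omega
  have hNp : N + p - 1 = T := by omega
  have hp0 : (0 : ℝ) < p := by exact_mod_cast hp
  have hp1 : (1 : ℝ) ≤ p := by exact_mod_cast hp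
  have hNT : (N : ℝ) ≤ T := by exact_mod_cast (by omega : N ≤ T)
  -- Chosen so that the exponential tail equals `δ` exactly.
  set γ := G * R * √(2 * p * T * D) with hγ
  have hγ0 : 0 ≤ γ := by positivity
  have hmain := measureReal_sum_gap_ge hn hloc h hlam hψ hψc hR hD hF hint hLip hsg hsub hsgG ha
    hx₁ hx1 hstep hxs hG hGR hp hN0 hγ0
  have hexp : Real.exp (-(γ ^ 2 / (2 * ((G * R) ^ 2 * p * (N + p - 1 : ℕ))))) = δ := by
    have h1 : γ ^ 2 / (2 * ((G * R) ^ 2 * p * (N + p - 1 : ℕ))) = D := by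
      rw [hNp, hγ, mul_pow, Real.sq_sqrt (by positivity), div_eq_iff (by positivity)]
      ring
    rw [h1, hDdef, one_div, Real.log_inv, neg_neg, Real.exp_log hδ]
  rw [hexp, hNp] at hmain
  refine hmain.trans (measureReal_mono fun ω hω => ?_)
  change ∑ s ∈ Finset.range N, (objective F loc (x (s + 1) ω) - objective F loc xs) ≤ _ at hω
  change _ ≤ migdBound n T R G a δ (1 - lam) ε
  rw [hbound]
  refine bound_le_of_mixing (p := p) (N := N) hR hG ha hε hT0 hp1 hpK hD0 (by linarith) hM2 hKM hNT
    ?_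
  refine (mul_average_le (convexOn_objective hψc.1 hFc hint) (hxX ω) hT _).trans ?_
  have hsplit : T = N + (p - 1) := by omega
  have hrange : ∑ s ∈ Finset.range T, (objective F loc (x (s + 1) ω) - objective F loc xs)
      = ∑ s ∈ Finset.range N, (objective F loc (x (s + 1) ω) - objective F loc xs)
      + ∑ s ∈ Finset.range (p - 1),
        (objective F loc (x (N + s + 1) ω) - objective F loc xs) := by
    conv_lhs => rw [hsplit]
    exact Finset.sum_range_add _ _ _
  have hlast : ∑ s ∈ Finset.range (p - 1),
      (objective F loc (x (N + s + 1) ω) - objective F loc xs) ≤ (p - 1) * (G * R) := by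
    refine (Finset.sum_le_sum fun s _ => hgapR _ (hxX ω (N + s + 1) (by omega))).trans_eq ?_
    rw [Finset.sum_const, Finset.card_range, nsmul_eq_mul, Nat.cast_sub hp, Nat.cast_one]
  rw [hrange]
  have hbias : (N : ℝ) * (√(n * lam ^ p) * (G * R)) ≤ N * (4 * ε * (G * R)) := by gcongr
  have hdrift : (2 * ((p : ℝ) - 1) + 1) * (a * G ^ 2 * √(N : ℝ))
      ≤ (2 * ((p : ℝ) - 1) + 1) * (a * G ^ 2 * √(T : ℝ)) := by
    have : 0 ≤ 2 * ((p : ℝ) - 1) + 1 := by linarith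
    gcongr
  linarith

end Main

end RandomMIGD

theorem corollary5 :
    ∃ C : ℝ, 0 < C ∧ C ≤ 4 ∧
      ∀ {E : Type*} [NormedAddCommGroup E] [NormedSpace ℝ E] [FiniteDimensional ℝ E]
        [MeasurableSpace E] [BorelSpace E]
        {Ξ : Type*} [MeasurableSpace Ξ]
        {Ω : Type*} [MeasurableSpace Ω] (μ : Measure Ω) [IsProbabilityMeasure μ]
        -- the network, the local distributions, and the random token and sample process
        (n : ℕ) (hn : 2 ≤ n)
        (loc : Fin n → Measure Ξ) (_ : ∀ i, IsProbabilityMeasure (loc i))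
        (P : ℕ → Ω → Matrix (Fin n) (Fin n) ℝ) (token : ℕ → Ω → Fin n) (ξ : ℕ → Ω → Ξ)
        (_ : RandomMIGD.IsRandomMIGDSampling μ loc P token ξ)
        (_ : RandomMIGD.lambdaTwo hn μ (P 1) < 1)
        -- the domain and the prox-function
        (X : Set E) (_ : IsCompact X) (_ : Convex ℝ X)
        (ψ : E → ℝ) (_ : DifferentiableOn ℝ ψ X) (_ : StrongConvexOn X 1 ψ)
        (R : ℝ) (_ : 0 ≤ R)
        (_ : ∀ x ∈ X, ∀ y ∈ X, RandomMIGD.bregman ψ X x y ≤ (1 / 2) * R ^ 2)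
        -- the convex functions, with a measurable selection of subgradients
        (F : E → Ξ → ℝ) (_ : ∀ z, ConvexOn ℝ X fun x => F x z)
        (_ : ∀ x ∈ X, Measurable (F x)) (_ : ∀ x ∈ X, ∀ i, Integrable (F x) (loc i))
        (G : ℝ) (_ : ∀ i, ∀ᵐ z ∂(loc i), ∀ x ∈ X, ∀ y ∈ X, |F x z - F y z| ≤ G * ‖x - y‖)
        (sg : E → Ξ → E →L[ℝ] ℝ) (_ : Measurable fun p : X × Ξ => sg p.1 p.2)
        (_ : ∀ z, ∀ x ∈ X, RandomMIGD.IsSubgradientOn (fun y => F y z) X x (sg x z))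
        (_ : ∀ i, ∀ᵐ z ∂(loc i), ∀ x ∈ X, ‖sg x z‖ ≤ G)
        -- the algorithm, with step sizes `a / √t`
        (a : ℝ) (_ : 0 < a) (x₁ : E) (_ : x₁ ∈ X)
        (x : ℕ → Ω → E) (_ : ∀ ω, x 1 ω = x₁)
        (_ : ∀ t : ℕ, 1 ≤ t → ∀ ω, RandomMIGD.IsMirrorStep ψ X (a / √(t : ℝ))
          (sg (x t ω) (ξ t ω)) (x t ω) (x (t + 1) ω))
        -- the horizon and the confidence level
        (T : ℕ) (_ : 1 ≤ T) (δ : ℝ) (_ : 0 < δ) (_ : δ ≤ 1),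
        1 - δ ≤ μ.real {ω | ∀ xs ∈ X, ∀ ε : ℝ, 0 < ε → ε < n * T / δ →
          RandomMIGD.objective F loc (RandomMIGD.average (fun t => x t ω) T)
              - RandomMIGD.objective F loc xs
            ≤ C * (R ^ 2 / (a * √(T : ℝ))
              + (Real.log (n / ε) + Real.log (T / δ)) / (1 - RandomMIGD.lambdaTwo hn μ (P 1))
                  * (G ^ 2 * a / √(T : ℝ))
              + ε * G * R
              + G * R / √(T : ℝ)
                * √(Real.log (T * n / (ε * δ))
                    * Real.log (1 / δ * Real.log (T * n / (ε * δ))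
                        / (1 - RandomMIGD.lambdaTwo hn μ (P 1)))
                    / (1 - RandomMIGD.lambdaTwo hn μ (P 1))))} := by
  refine ⟨4, by norm_num, le_rfl, ?_⟩
  intro E _ _ _ _ _ Ξ _ Ω _ μ _ n hn loc hloc P token ξ h hlam X hXc hX ψ hψ hψc R hR hD F hFc hF
    hint G hLip sg hsg hsub hsgG a ha x₁ hx₁ x hx1 hstep T hT δ hδ hδ1
  have hn0 : 0 < n := by omega
  -- An almost sure property of a probability measure holds at some point, where `G` dominates a
  -- norm.
  have hG : 0 ≤ G := by
    obtain ⟨z, hz⟩ := (hsgG ⟨0, hn0⟩).exists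
    exact (norm_nonneg _).trans (hz x₁ hx₁)
  have hcont := RandomMIGD.continuousOn_objective hn0 hloc hint hG hLip
  -- A deterministic minimizer is the hardest competitor, so the bound against it covers every `xs`
  -- at once.
  obtain ⟨xm, hxm, hmin⟩ := hXc.exists_isMinOn ⟨x₁, hx₁⟩ hcont
  have hxX := RandomMIGD.iterate_mem hx₁ hx1 hstep
  have hn1 : (0 : ℝ) < n := by exact_mod_cast hn0
  have hT0 : (0 : ℝ) < T := by exact_mod_cast hT
  have hxmeas : ∀ t, 1 ≤ t → Measurable (x t) := fun t ht => by
    obtain ⟨s, rfl⟩ : ∃ s, t = s + 1 := ⟨t - 1, by omega⟩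
    exact (RandomMIGD.measurable_iterate hψ hψc ha hsg hx₁ hx1 hstep s).mono (h.history_le s) le_rfl
  have havg : Measurable fun ω => RandomMIGD.average (fun t => x t ω) T := by
    have : ProperSpace E := FiniteDimensional.proper_real E
    exact (Finset.measurable_sum _ fun t ht => hxmeas t (Finset.mem_Icc.1 ht).1).const_smul
      (1 / (T : ℝ))
  have hZ := (RandomMIGD.measurable_comp_of_continuousOn hcont havg fun ω =>
    RandomMIGD.average_mem hX (hxX ω) hT).sub_const (RandomMIGD.objective F loc xm)
  have : Nonempty (Set.Ioo (0 : ℝ) (n * T / δ)) :=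
    (Set.nonempty_Ioo.2 (by positivity)).to_subtype
  refine (RandomMIGD.le_measureReal_forall_le hZ (r := fun ε : Set.Ioo (0 : ℝ) (n * T / δ) =>
    RandomMIGD.migdBound n T R G a δ (1 - RandomMIGD.lambdaTwo hn μ (P 1)) ε) ?_ ?_).trans
    (measureReal_mono ?_)
  · refine ⟨0, ?_⟩
    rintro _ ⟨ε, rfl⟩
    exact RandomMIGD.migdBound_nonneg hn0 hT hR hG ha hδ (by linarith) ε.2.1 ε.2.2
  · exact fun ε => RandomMIGD.measureReal_average_ge hn hloc h hlam hψ hψc hR hD hFc hF hint hLip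
      hsg hsub hsgG hG ha hx₁ hx1 hstep hxm hT hδ hδ1 ε.2.1 ε.2.2
  · intro ω hω xs hxs ε hε hεn
    have h1 : RandomMIGD.objective F loc xm ≤ RandomMIGD.objective F loc xs := hmin hxs
    have h2 := hω ⟨ε, hε, hεn⟩
    exact (sub_le_sub_left h1 _).trans h2
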